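/- For a parameter $p\in(0,1)$, the random-surfer tree with $n$ vertices is the random tree generated as follows. Start with a single vertex $v_0$, the root, carrying a self-loop. At each step $s=1,\dots,n-1$ a new vertex $v_s$ appears and sends one directed edge to an old vertex: choose $u$ uniformly at random from $\{v_0,\dots,v_{s-1}\}$ and, independently of $u$ and of the past, a random variable $X$ with $\mathbf P(X=k)=(1-p)^k p$ for $k=0,1,2,\dots$; perform a simple random walk of length $X$ from $u$ along the directed edges, and join $v_s$ to the last vertex of the walk. Finally delete the self-loop of the root and ignore the directions of the edges. Let $s=s(p)$ be the unique solution in $(0,1)$ of $$s\log\left(\frac{(1-p)(2-s)}{1-s}\right)=1,$$ and let $p_0\approx 0.206$ be the unique solution in $(0,1/2)$ of $$\log\left(\frac{1-p_0}{p_0}\right)=\frac{1-p_0}{1-2p_0}.$$ Put $$c_L(p)=\exp(1/s)\,s\,(2-s)\,p,\qquad c_U(p)=\begin{cases}c_L(p) & \text{if } p_0\le p<1,\\ \left(\log\left(\frac{1-p}{p}\right)\right)^{-1} & \text{if } 0<p<p_0.\end{cases}$$ **Theorem.** Let $p\in(0,1)$. For every fixed $\varepsilon>0$, with probability tending to $1$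 as $n\to\infty$, the diameter of the random-surfer tree with $n$ vertices and parameter $p$ (the maximum graph distance between two vertices) is between $(2c_L(p)-\varepsilon)\log n$ and $(2c_U(p)+\varepsilon)\log n$. Here $\log$ is the natural logarithm. -/

import Mathlib

open Filter Topology

namespace RandomSurfer

/-! ### The random-surfer Webgraph model -/

/-- A directed multigraph with vertices `v₀, v₁, …` in which every vertex has out-degree `d`:
`g i j` is the index of the head of the `j`-th edge that leaves `vᵢ`. While only the vertices
`v₀, …, v_{s-1}` exist, the values `g i j` with `i ≥ s` carry no meaning (they are kept at `0`). -/
abbrev Webgraph (d : ℕ) : Type := ℕ → Fin d → ℕ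

/-- The geometric distribution with `P(Geo(p) = k) = (1 - p) ^ k * p` for `k = 0, 1, 2, …`. -/
noncomputable def geo (p : ℝ) (hp : p ∈ Set.Ioc (0 : ℝ) 1) : PMF ℕ :=
  (ProbabilityTheory.geometricMeasure ⟨p, hp.1.le, hp.2⟩).toPMF

/-- The law of the last vertex of a simple random walk of length `k` on `g` that starts at `u`:
every step follows a uniformly random out-going edge of the current vertex. -/
noncomputable def walkEnd {d : ℕ} [NeZero d] (g : Webgraph d) : ℕ → ℕ → PMF ℕ
  | 0, u => PMF.pure u
  | k + 1, u => (PMF.uniformOfFintype (Fin d)).bind fun j => walkEnd g k (g u j)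

/-- The law of a family of `d` independent random variables, each with law `q`. -/
noncomputable def iid {α : Type*} (q : PMF α) : (d : ℕ) → PMF (Fin d → α)
  | 0 => PMF.pure Fin.elim0
  | d + 1 => q.bind fun a => (iid q d).bind fun r =>
      PMF.pure (Fin.cons (α := fun _ : Fin (d + 1) => α) a r)

/-- The law of the head of one new edge when the vertices present are `v₀, …, vₛ`: the end of a
random walk of geometric length that starts at a uniformly random vertex. -/
noncomputable def newHead (p : ℝ) (hp : p ∈ Set.Ioc (0 : ℝ) 1) {d : ℕ} [NeZero d]
    (g : Webgraph d) (s : ℕ) : PMF ℕ :=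
  (PMF.uniformOfFintype (Fin (s + 1))).bind fun u =>
    (geo p hp).bind fun x => walkEnd g x u

/-- The law of the random-surfer Webgraph after `s` steps, when its vertices are `v₀, …, vₛ`.
It starts with the root `v₀` and its `d` self-loops; step `s + 1` adds the vertex `v_{s+1}` and
`d` edges from it, whose heads are independent given the present graph. -/
noncomputable def webgraphLaw (p : ℝ) (hp : p ∈ Set.Ioc (0 : ℝ) 1) (d : ℕ) [NeZero d] :
    ℕ → PMF (Webgraph d)
  | 0 => PMF.pure fun _ _ => 0
  | s + 1 => (webgraphLaw p hp d s).bind fun g =>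
      (iid (newHead p hp g s) d).map fun heads => Function.update g (s + 1) heads

/-- The simple undirected graph on `v₀, …, v_{n-1}` that underlies a directed multigraph: loops
are deleted and directions are ignored. -/
def underlying {d : ℕ} (n : ℕ) (g : Webgraph d) : SimpleGraph (Fin n) :=
  SimpleGraph.fromRel fun i j => ∃ k : Fin d, g i k = (j : ℕ)

/-- The law of the random-surfer tree with `n ≥ 1` vertices: the underlying undirected graph of
the random-surfer Webgraph with `d = 1` after `n - 1` steps. -/
noncomputable def treeLaw (p : ℝ) (hp : p ∈ Set.Ioc (0 : ℝ) 1) (n : ℕ) :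
    PMF (SimpleGraph (Fin n)) :=
  (webgraphLaw p hp 1 (n - 1)).map (underlying n)

/-! ### The constants -/

/-- `s` is a solution in `(0, 1)` of `s * log ((1 - p) * (2 - s) / (1 - s)) = 1`. -/
def IsSurferS (p s : ℝ) : Prop :=
  s ∈ Set.Ioo (0 : ℝ) 1 ∧ s * Real.log ((1 - p) * (2 - s) / (1 - s)) = 1

/-- `q` is a solution in `(0, 1/2)` of `log ((1 - q) / q) = (1 - q) / (1 - 2 * q)`. -/
def IsThreshold (q : ℝ) : Prop :=
  q ∈ Set.Ioo (0 : ℝ) (1 / 2) ∧ Real.log ((1 - q) / q) = (1 - q) / (1 - 2 * q)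

theorem existsUnique_isSurferS (p : ℝ) (hp : p ∈ Set.Ioo (0 : ℝ) 1) :
    ∃! s, IsSurferS p s := by
  obtain ⟨hp0, hp1⟩ := hp
  have h1p : 0 < 1 - p := by linarith
  have harg : ∀ s : ℝ, s < 1 → 0 < (1 - p) * (2 - s) / (1 - s) := fun s hs =>
    div_pos (mul_pos h1p (by linarith)) (by linarith)
  have hex : ∃ s, IsSurferS p s := by
    have he2 : (2 : ℝ) < Real.exp 2 := by
      have := Real.add_one_lt_exp (x := 2) (by norm_num)
      linarith
    set δ : ℝ := (1 - p) / Real.exp 2 with hδ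
    have hδ0 : 0 < δ := by positivity
    have hδ1 : δ < 1 / 2 := by
      rw [hδ, div_lt_iff₀ (by positivity)]
      linarith
    have hδe : 1 - p = δ * Real.exp 2 := by rw [hδ]; field_simp
    have hcont : ContinuousOn (fun s : ℝ => s * Real.log ((1 - p) * (2 - s) / (1 - s)))
        (Set.Icc (1 / 2) (1 - δ)) := by
      refine continuousOn_id.mul (ContinuousOn.log ?_ ?_)
      · refine ContinuousOn.div (by fun_prop) (by fun_prop) ?_
        intro x hx
        have := hx.2
        intro h
        linarith
      · intro x hx
        exact (harg x (by linarith [hx.2])).ne'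
    have hlow : (1 / 2 : ℝ) * Real.log ((1 - p) * (2 - 1 / 2) / (1 - 1 / 2)) ≤ 1 := by
      have h3 : Real.log ((1 - p) * (2 - 1 / 2) / (1 - 1 / 2)) ≤ 2 := by
        have := Real.log_le_sub_one_of_pos (harg (1 / 2) (by norm_num))
        have h4 : (1 - p) * (2 - 1 / 2) / (1 - 1 / 2) = 3 * (1 - p) := by ring
        rw [h4] at this ⊢
        linarith
      linarith
    have hhigh : 1 ≤ (1 - δ) * Real.log ((1 - p) * (2 - (1 - δ)) / (1 - (1 - δ))) := by
      have h5 : (1 - p) * (2 - (1 - δ)) / (1 - (1 - δ)) = Real.exp 2 * (1 + δ) := by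
        rw [hδe]
        have : 1 - (1 - δ) = δ := by ring
        rw [this]
        field_simp
        ring
      have h6 : 2 ≤ Real.log (Real.exp 2 * (1 + δ)) := by
        rw [Real.log_mul (by positivity) (by positivity), Real.log_exp]
        have := Real.log_nonneg (x := 1 + δ) (by linarith)
        linarith
      rw [h5]
      nlinarith
    obtain ⟨s, hs, hs'⟩ := intermediate_value_Icc (by linarith) hcont ⟨hlow, hhigh⟩
    exact ⟨s, ⟨by linarith [hs.1], by linarith [hs.2]⟩, hs'⟩
  have hlt : ∀ a b : ℝ, IsSurferS p a → IsSurferS p b → ¬ a < b := by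
    rintro a b ⟨⟨ha0, ha1⟩, ha⟩ ⟨⟨hb0, hb1⟩, hb⟩ hab
    have hla : 0 < Real.log ((1 - p) * (2 - a) / (1 - a)) := by
      by_contra h
      push Not at h
      nlinarith
    have hll : Real.log ((1 - p) * (2 - a) / (1 - a)) <
        Real.log ((1 - p) * (2 - b) / (1 - b)) := by
      refine Real.log_lt_log (harg a ha1) ?_
      rw [div_lt_div_iff₀ (by linarith) (by linarith)]
      have : (2 - a) * (1 - b) < (2 - b) * (1 - a) := by nlinarith
      nlinarith
    nlinarith
  obtain ⟨s, hs⟩ := hex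
  refine ⟨s, hs, fun t ht => ?_⟩
  exact le_antisymm (not_lt.1 (hlt s t hs ht)) (not_lt.1 (hlt t s ht hs))

theorem existsUnique_isThreshold : ∃! q, IsThreshold q := by
  have hex : ∃ q, IsThreshold q := by
    have hcont : ContinuousOn
        (fun q : ℝ => (1 - q) / (1 - 2 * q) - Real.log ((1 - q) / q))
        (Set.Icc (1 / 10) (1 / 3)) := by
      refine ContinuousOn.sub ?_ (ContinuousOn.log ?_ ?_)
      · refine ContinuousOn.div (by fun_prop) (by fun_prop) ?_
        intro x hx h
        linarith [hx.2]
      · refine ContinuousOn.div (by fun_prop) (by fun_prop) ?_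
        intro x hx h
        linarith [hx.1]
      · intro x hx
        exact (div_pos (by linarith [hx.2]) (by linarith [hx.1])).ne'
    have hlow : (1 - 1 / 10 : ℝ) / (1 - 2 * (1 / 10)) -
        Real.log ((1 - 1 / 10) / (1 / 10)) ≤ 0 := by
      have h1 : ((1 - 1 / 10 : ℝ) / (1 / 10)) = 3 ^ 2 := by norm_num
      have h2 : (1 : ℝ) ≤ Real.log 3 := by
        rw [Real.le_log_iff_exp_le (by norm_num)]
        linarith [Real.exp_one_lt_d9]
      rw [h1, Real.log_pow]
      norm_num
      linarith
    have hhigh : (0 : ℝ) ≤ (1 - 1 / 3 : ℝ) / (1 - 2 * (1 / 3)) -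
        Real.log ((1 - 1 / 3) / (1 / 3)) := by
      have h1 : ((1 - 1 / 3 : ℝ) / (1 / 3)) = 2 := by norm_num
      have h2 := Real.log_two_lt_d9
      rw [h1]
      norm_num
      linarith
    obtain ⟨q, hq, hq'⟩ := intermediate_value_Icc (by norm_num) hcont ⟨hlow, hhigh⟩
    refine ⟨q, ⟨by linarith [hq.1], by linarith [hq.2]⟩, ?_⟩
    simp only at hq'
    linarith
  have hlt : ∀ a b : ℝ, IsThreshold a → IsThreshold b → ¬ a < b := by
    rintro a b ⟨⟨ha0, ha1⟩, ha⟩ ⟨⟨hb0, hb1⟩, hb⟩ hab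
    have h1 : Real.log ((1 - b) / b) < Real.log ((1 - a) / a) := by
      refine Real.log_lt_log (div_pos (by linarith) hb0) ?_
      rw [div_lt_div_iff₀ hb0 ha0]
      nlinarith
    have h2 : (1 - a) / (1 - 2 * a) < (1 - b) / (1 - 2 * b) := by
      rw [div_lt_div_iff₀ (by linarith) (by linarith)]
      nlinarith
    linarith
  obtain ⟨q, hq⟩ := hex
  refine ⟨q, hq, fun t ht => ?_⟩
  exact le_antisymm (not_lt.1 (hlt q t hq ht)) (not_lt.1 (hlt t q ht hq))

/-- `s(p)`, the unique solution in `(0, 1)` of `s * log ((1 - p) * (2 - s) / (1 - s)) = 1`, for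
`p ∈ (0, 1)`. -/
noncomputable def surferS (p : ℝ) (hp : p ∈ Set.Ioo (0 : ℝ) 1) : ℝ :=
  (existsUnique_isSurferS p hp).choose

/-- `p₀ ≈ 0.206`, the unique solution in `(0, 1/2)` of
`log ((1 - p) / p) = (1 - p) / (1 - 2 * p)`. -/
noncomputable def p₀ : ℝ := existsUnique_isThreshold.choose

/-- `c_L(p) = exp (1 / s) * s * (2 - s) * p` with `s = s(p)`. -/
noncomputable def cL (p : ℝ) (hp : p ∈ Set.Ioo (0 : ℝ) 1) : ℝ :=
  Real.exp (1 / surferS p hp) * surferS p hp * (2 - surferS p hp) * p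

open scoped Classical in
/-- `c_U(p)`, which is `c_L(p)` for `p₀ ≤ p < 1` and `(log ((1 - p) / p))⁻¹` for `0 < p < p₀`. -/
noncomputable def cU (p : ℝ) (hp : p ∈ Set.Ioo (0 : ℝ) 1) : ℝ :=
  if p₀ ≤ p then cL p hp else (Real.log ((1 - p) / p))⁻¹

end RandomSurfer

/-! A vertex that starts its walk at `u` lands at depth `(depth u - X)⁺ + 1`, so depths perform a
branching walk with displacement `1 - X`, truncated at the root. Write `φ θ = expMoment p θ` for the
exponential moment of `1 - X`.

Upper bound: without truncation, the arrival of `v_{s+1}` multiplies the mean of `∑ exp (θ depth)`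
by `1 + φ θ / (s + 1)`. Truncation adds at most `exp θ` per step, which costs only a logarithm when
`1 ≤ φ θ` (`mean_layeredLaw_expTotal_le`). By Markov, no depth exceeds `a log n` once `a > φ θ / θ`,
and the diameter is at most twice the height. The quotient is minimal at `θ = 1 / s(p)`, with value
`c_L`. This point is admissible for `p₀ ≤ p` (`one_le_expMoment_of_p₀_le`); for smaller `p` one
takes `θ = log ((1 - p) / p)`, where `φ θ = 1`.

Lower bound: freeze the first `2m` vertices as a zone, measure depth below it, colour half of the
zone `true` and the rest `false`, and let a new vertex inherit the colour of its starting vertex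
`u`. Depth signed by colour is 1-Lipschitz along edges, so the depths of two vertices of opposite
colours add up to at most the diameter (`add_depth_le_diam`). It remains to find deep vertices of
each colour. The Laplace functional of a colour class is pushed backwards in time
(`mean_stepLaw_exp_neg_total_le`): one arrival replaces a profile `h` by `h + κ / (s + 1) * displace
p h`. For `l < c_L`, a block that multiplies the number of vertices by `M` turns a step at `y + l
log M` into at least the same step at `y` (`exists_block`). After `K` blocks the step sits at `0`,
where each of the `m` zone vertices of the colour contributes `c`; hence failure has probability at
most `exp (-c m)` (`exists_deep_of_color`), and `m` is arbitrary. -/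

namespace RandomSurfer

open scoped ENNReal

/-! ### Expectations of nonnegative functions under a discrete law -/

/-- The expectation of `f` under the discrete law `μ`. -/
noncomputable def mean {α : Type*} (μ : PMF α) (f : α → ℝ≥0∞) : ℝ≥0∞ := ∑' a, μ a * f a

section Mean

variable {α β : Type*}

theorem mean_pure (a : α) (f : α → ℝ≥0∞) : mean (PMF.pure a) f = f a := by
  rw [mean, tsum_eq_single a]
  · simp
  · intro b hb
    simp [PMF.pure_apply_of_ne a b hb]

theorem mean_bind (μ : PMF α) (κ : α → PMF β) (f : β → ℝ≥0∞) :
    mean (μ.bind κ) f = mean μ fun a => mean (κ a) f := by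
  simp only [mean, PMF.bind_apply, ← ENNReal.tsum_mul_right, ← ENNReal.tsum_mul_left]
  rw [ENNReal.tsum_comm]
  simp only [mul_assoc]

theorem mean_map (μ : PMF α) (g : α → β) (f : β → ℝ≥0∞) :
    mean (μ.map g) f = mean μ (f ∘ g) := by
  rw [← PMF.bind_pure_comp, mean_bind]
  simp only [Function.comp_apply, mean_pure]
  rfl

theorem mean_mono {μ : PMF α} {f g : α → ℝ≥0∞} (h : ∀ a ∈ μ.support, f a ≤ g a) :
    mean μ f ≤ mean μ g := by
  refine ENNReal.tsum_le_tsum fun a => ?_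
  by_cases ha : a ∈ μ.support
  · exact mul_le_mul_right (h a ha) _
  · simp [(μ.apply_eq_zero_iff a).2 ha]

theorem mean_const (μ : PMF α) (c : ℝ≥0∞) : mean μ (fun _ => c) = c := by
  rw [mean, ENNReal.tsum_mul_right, μ.tsum_coe, one_mul]

theorem mean_add (μ : PMF α) (f g : α → ℝ≥0∞) :
    mean μ (fun a => f a + g a) = mean μ f + mean μ g := by
  simp only [mean, mul_add, ENNReal.tsum_add]

theorem mean_mul_left (μ : PMF α) (c : ℝ≥0∞) (f : α → ℝ≥0∞) :
    mean μ (fun a => c * f a) = c * mean μ f := by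
  simp only [mean, ← ENNReal.tsum_mul_left, mul_left_comm]

theorem toOuterMeasure_le_mean (μ : PMF α) {S : Set α} {f : α → ℝ≥0∞}
    (h : ∀ a ∈ μ.support, a ∈ S → 1 ≤ f a) : μ.toOuterMeasure S ≤ mean μ f := by
  rw [PMF.toOuterMeasure_apply]
  refine ENNReal.tsum_le_tsum fun a => ?_
  by_cases haS : a ∈ S
  · rw [Set.indicator_of_mem haS]
    by_cases ha : a ∈ μ.support
    · exact le_mul_of_one_le_right' (h a ha haS)
    · simp [(μ.apply_eq_zero_iff a).2 ha]
  · simp [haS]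

theorem mean_uniformOfFintype_fin (s : ℕ) (f : Fin (s + 1) → ℝ≥0∞) :
    mean (PMF.uniformOfFintype (Fin (s + 1))) f = (∑ u, f u) * ((s : ℝ≥0∞) + 1)⁻¹ := by
  rw [mean, tsum_fintype, Finset.sum_mul]
  refine Finset.sum_congr rfl fun u _ => ?_
  rw [PMF.uniformOfFintype_apply, mul_comm]
  simp

theorem geo_apply (p : ℝ) (hp : p ∈ Set.Ioc (0 : ℝ) 1) (k : ℕ) :
    geo p hp k = ENNReal.ofReal ((1 - p) ^ k * p) := by
  rw [geo, MeasureTheory.Measure.toPMF_apply, ProbabilityTheory.geometricMeasure_singleton]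
  intro h
  exact hp.1.ne' (congrArg Subtype.val h)

theorem mean_geo_ofReal (p : ℝ) (hp : p ∈ Set.Ioc (0 : ℝ) 1) {f : ℕ → ℝ} (h0 : ∀ k, 0 ≤ f k)
    (hs : Summable fun k => (1 - p) ^ k * p * f k) :
    mean (geo p hp) (fun k => ENNReal.ofReal (f k)) =
      ENNReal.ofReal (∑' k, (1 - p) ^ k * p * f k) := by
  have hq : 0 ≤ 1 - p := by linarith [hp.2]
  have hw : ∀ k, 0 ≤ (1 - p) ^ k * p := fun k => mul_nonneg (pow_nonneg hq k) hp.1.le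
  rw [ENNReal.ofReal_tsum_of_nonneg (fun k => mul_nonneg (hw k) (h0 k)) hs, mean]
  refine tsum_congr fun k => ?_
  rw [geo_apply, ENNReal.ofReal_mul (hw k)]

end Mean

/-! ### The layered chain -/

/-- A Webgraph of out-degree one whose vertices carry a depth and a colour. -/
structure Layered where
  /-- the underlying Webgraph -/
  graph : Webgraph 1
  /-- the depth of a vertex below the zone of the initial vertices -/
  depth : ℕ → ℕ
  /-- the colour of a vertex -/
  color : ℕ → Bool

namespace Layered

/-- The head of the only edge that leaves `vᵢ`. -/
def parent (σ : Layered) (i : ℕ) : ℕ := σ.graph i 0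

/-- The vertex `v_{s+1}` is attached to the end of the walk of length `x` from `u`; it inherits the
colour of `u`. -/
def step (s : ℕ) (σ : Layered) (u x : ℕ) : Layered where
  graph := Function.update σ.graph (s + 1) fun _ => σ.parent^[x] u
  depth := Function.update σ.depth (s + 1) (σ.depth u - x + 1)
  color := Function.update σ.color (s + 1) (σ.color u)

/-- The consistency conditions of a layered Webgraph on `v₀, …, vₛ` with zone `v₀, …, vᵣ`. -/
structure Valid (r s : ℕ) (σ : Layered) : Prop where
  parent_zero : σ.parent 0 = 0
  parent_lt : ∀ i, 0 < i → i ≤ s → σ.parent i < i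
  depth_zone : ∀ i ≤ r, σ.depth i = 0
  depth_parent : ∀ i, r < i → i ≤ s → σ.depth i = σ.depth (σ.parent i) + 1
  color_parent : ∀ i ≤ s, σ.depth (σ.parent i) ≠ 0 → σ.color (σ.parent i) = σ.color i

variable {r s : ℕ} {σ : Layered}

theorem Valid.parent_le (h : σ.Valid r s) {i : ℕ} (hi : i ≤ s) : σ.parent i ≤ i := by
  rcases Nat.eq_zero_or_pos i with rfl | h0
  · exact h.parent_zero.le
  · exact (h.parent_lt i h0 hi).le

theorem Valid.depth_parent_eq_sub (h : σ.Valid r s) {i : ℕ} (hi : i ≤ s) :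
    σ.depth (σ.parent i) = σ.depth i - 1 := by
  by_cases hr : i ≤ r
  · rw [h.depth_zone i hr, h.depth_zone _ ((h.parent_le hi).trans hr)]
  · rw [h.depth_parent i (by omega) hi]
    rfl

/-- The truncated subtraction is exact: a walk that has entered the zone stays there, at depth `0`.
Colour can change only on entering the zone. -/
theorem Valid.iterate_parent (h : σ.Valid r s) {u : ℕ} (hu : u ≤ s) (x : ℕ) :
    σ.parent^[x] u ≤ u ∧ σ.depth (σ.parent^[x] u) = σ.depth u - x ∧
      (σ.depth (σ.parent^[x] u) ≠ 0 → σ.color (σ.parent^[x] u) = σ.color u) := by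
  induction x with
  | zero => simp
  | succ x ih =>
    obtain ⟨h1, h2, h3⟩ := ih
    have hs := h1.trans hu
    have hd := h.depth_parent_eq_sub hs
    rw [Function.iterate_succ_apply']
    refine ⟨(h.parent_le hs).trans h1, by omega, fun h0 => ?_⟩
    rw [h.color_parent _ hs h0, h3 (by omega)]

theorem Valid.step (h : σ.Valid r s) (hrs : r ≤ s) {u : ℕ} (hu : u ≤ s) (x : ℕ) :
    (σ.step s u x).Valid r (s + 1) := by
  obtain ⟨h1, h2, h3⟩ := h.iterate_parent hu x
  have hpar : ∀ i, i ≤ s → (σ.step s u x).parent i = σ.parent i := fun i hi => by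
    simp [Layered.step, parent, Function.update_of_ne (show i ≠ s + 1 by omega)]
  have hdep : ∀ i, i ≤ s → (σ.step s u x).depth i = σ.depth i := fun i hi => by
    simp [Layered.step, Function.update_of_ne (show i ≠ s + 1 by omega)]
  have hcol : ∀ i, i ≤ s → (σ.step s u x).color i = σ.color i := fun i hi => by
    simp [Layered.step, Function.update_of_ne (show i ≠ s + 1 by omega)]
  have hpar' : (σ.step s u x).parent (s + 1) = σ.parent^[x] u := by simp [Layered.step, parent]
  have hdep' : (σ.step s u x).depth (s + 1) = σ.depth u - x + 1 := by simp [Layered.step]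
  have hcol' : (σ.step s u x).color (s + 1) = σ.color u := by simp [Layered.step]
  refine ⟨?_, ?_, ?_, ?_, ?_⟩
  · rw [hpar 0 (by omega), h.parent_zero]
  · intro i h0 hi
    rcases Nat.lt_or_ge s i with hsi | hsi
    · obtain rfl : i = s + 1 := by omega
      rw [hpar']
      omega
    · rw [hpar i hsi]
      exact h.parent_lt i h0 hsi
  · intro i hi
    rw [hdep i (by omega), h.depth_zone i hi]
  · intro i hri hi
    rcases Nat.lt_or_ge s i with hsi | hsi
    · obtain rfl : i = s + 1 := by omega
      rw [hpar', hdep', hdep _ (h1.trans hu), h2]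
    · rw [hpar i hsi, hdep i hsi, hdep _ ((h.parent_le hsi).trans hsi), h.depth_parent i hri hsi]
  · intro i hi
    rcases Nat.lt_or_ge s i with hsi | hsi
    · obtain rfl : i = s + 1 := by omega
      rw [hpar', hcol', hdep _ (h1.trans hu), hcol _ (h1.trans hu)]
      exact h3
    · have := (h.parent_le hsi).trans hsi
      rw [hpar i hsi, hdep _ this, hcol _ this, hcol i hsi]
      exact h.color_parent i hsi

end Layered

/-! ### Coupling of the layered chain with the Webgraph -/

/-- The law of the layered Webgraph after the arrival of `v_{s+1}`. -/
noncomputable def stepLaw (p : ℝ) (hp : p ∈ Set.Ioc (0 : ℝ) 1) (s : ℕ) (σ : Layered) :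
    PMF Layered :=
  (PMF.uniformOfFintype (Fin (s + 1))).bind fun u => (geo p hp).map fun x => σ.step s u x

/-- The random-surfer Webgraph on `v₀, …, v_{r+k}`, with depths measured below `v₀, …, vᵣ` and
colours that extend the given colours `c` of these vertices. -/
noncomputable def layeredLaw (p : ℝ) (hp : p ∈ Set.Ioc (0 : ℝ) 1) (r : ℕ) (c : ℕ → Bool) :
    ℕ → PMF Layered
  | 0 => (webgraphLaw p hp 1 r).map fun g => ⟨g, fun _ => 0, c⟩
  | k + 1 => (layeredLaw p hp r c k).bind (stepLaw p hp (r + k))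

/-- With out-degree one the walk is deterministic, so only its start and its length are random. -/
theorem walkEnd_one (g : Webgraph 1) (x u : ℕ) :
    walkEnd g x u = PMF.pure ((fun i => g i 0)^[x] u) := by
  induction x generalizing u with
  | zero => rfl
  | succ x ih =>
    have h1 : PMF.uniformOfFintype (Fin 1) = PMF.pure 0 := by
      ext a
      rw [Subsingleton.elim a 0]
      simp
    rw [walkEnd, h1, PMF.pure_bind, ih, Function.iterate_succ_apply]

theorem iid_one {α : Type*} (q : PMF α) : iid q 1 = q.map fun a _ => a := by
  rw [← PMF.bind_pure_comp, iid]
  congr 1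
  funext a
  rw [iid, PMF.pure_bind]
  simp only [Function.comp_apply]
  congr 1
  funext i
  exact Fin.cases rfl (fun j => j.elim0) i

theorem map_graph_stepLaw (p : ℝ) (hp : p ∈ Set.Ioc (0 : ℝ) 1) (s : ℕ) (σ : Layered) :
    (stepLaw p hp s σ).map Layered.graph =
      (iid (newHead p hp σ.graph s) 1).map fun heads => Function.update σ.graph (s + 1) heads := by
  rw [iid_one, PMF.map_comp, newHead, stepLaw, PMF.map_bind, PMF.map_bind]
  congr 1
  funext u
  rw [PMF.map_comp, PMF.map_bind, ← PMF.bind_pure_comp]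
  congr 1
  funext x
  rw [walkEnd_one, PMF.pure_map]
  rfl

/-- Depths and colours are bookkeeping that never influences the graph. The zone size and the
colouring may therefore be chosen freely in each bound. -/
theorem map_graph_layeredLaw (p : ℝ) (hp : p ∈ Set.Ioc (0 : ℝ) 1) (r : ℕ) (c : ℕ → Bool)
    (k : ℕ) : (layeredLaw p hp r c k).map Layered.graph = webgraphLaw p hp 1 (r + k) := by
  induction k with
  | zero =>
    rw [layeredLaw, PMF.map_comp]
    exact PMF.map_id _
  | succ k ih =>
    rw [layeredLaw, PMF.map_bind, ← add_assoc, webgraphLaw, ← ih, PMF.bind_map]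
    congr 1
    funext σ
    exact map_graph_stepLaw p hp (r + k) σ

theorem mem_support_stepLaw {p : ℝ} {hp : p ∈ Set.Ioc (0 : ℝ) 1} {s : ℕ} {σ τ : Layered}
    (h : τ ∈ (stepLaw p hp s σ).support) : ∃ u ≤ s, ∃ x, τ = σ.step s u x := by
  rw [stepLaw, PMF.mem_support_bind_iff] at h
  obtain ⟨u, -, h⟩ := h
  rw [PMF.mem_support_map_iff] at h
  obtain ⟨x, -, rfl⟩ := h
  exact ⟨u, by omega, x, rfl⟩

theorem valid_of_mem_support_webgraphLaw {p : ℝ} {hp : p ∈ Set.Ioc (0 : ℝ) 1} {s : ℕ}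
    (c : ℕ → Bool) {g : Webgraph 1} (h : g ∈ (webgraphLaw p hp 1 s).support) :
    Layered.Valid s s ⟨g, fun _ => 0, c⟩ := by
  suffices hg : g 0 0 = 0 ∧ ∀ i, 0 < i → i ≤ s → g i 0 < i from
    ⟨hg.1, hg.2, fun _ _ => rfl, fun i h1 h2 => by omega, fun _ _ h => absurd rfl h⟩
  induction s generalizing g with
  | zero =>
    rw [webgraphLaw, PMF.mem_support_pure_iff] at h
    subst h
    exact ⟨rfl, fun i h1 h2 => by omega⟩
  | succ s ih =>
    rw [webgraphLaw, PMF.mem_support_bind_iff] at h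
    obtain ⟨g', hg', h⟩ := h
    obtain ⟨i1, i2⟩ := ih hg'
    have hval : Layered.Valid s s ⟨g', fun _ => 0, c⟩ :=
      ⟨i1, i2, fun _ _ => rfl, fun i h1 h2 => by omega, fun _ _ h => absurd rfl h⟩
    rw [← map_graph_stepLaw p hp s ⟨g', fun _ => 0, c⟩, PMF.mem_support_map_iff] at h
    obtain ⟨τ, hτ, rfl⟩ := h
    obtain ⟨u, hu, x, rfl⟩ := mem_support_stepLaw hτ
    have := hval.step le_rfl hu x
    exact ⟨this.parent_zero, this.parent_lt⟩

theorem valid_of_mem_support_layeredLaw {p : ℝ} {hp : p ∈ Set.Ioc (0 : ℝ) 1} {r : ℕ}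
    {c : ℕ → Bool} {k : ℕ} {σ : Layered} (h : σ ∈ (layeredLaw p hp r c k).support) :
    σ.Valid r (r + k) := by
  induction k generalizing σ with
  | zero =>
    rw [layeredLaw, PMF.mem_support_map_iff] at h
    obtain ⟨g, hg, rfl⟩ := h
    exact valid_of_mem_support_webgraphLaw c hg
  | succ k ih =>
    rw [layeredLaw, PMF.mem_support_bind_iff] at h
    obtain ⟨σ', hσ', h⟩ := h
    obtain ⟨u, hu, x, rfl⟩ := mem_support_stepLaw h
    exact (ih hσ').step (by omega) hu x

/-! ### Distances in the underlying tree -/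

section Distance

variable {n : ℕ}

theorem underlying_adj {g : Webgraph 1} {i j : Fin n} :
    (underlying n g).Adj i j ↔ i ≠ j ∧ (g i 0 = j ∨ g j 0 = i) := by
  simp [underlying, SimpleGraph.fromRel_adj, Fin.exists_fin_one]

/-- For `r = 0` the zone is the root alone and depth is the length of the parent path. For larger
zones only connectivity is used. -/
theorem Layered.Valid.exists_walk_zero {r s : ℕ} {σ : Layered} (h : σ.Valid r s) (hn : n ≤ s + 1)
    (h0 : 0 < n) (i : Fin n) :
    ∃ w : (underlying n σ.graph).Walk i ⟨0, h0⟩, (r = 0 → w.length = σ.depth i) := by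
  obtain ⟨i, hi⟩ := i
  induction i using Nat.strong_induction_on with
  | _ i ih =>
    rcases Nat.eq_zero_or_pos i with rfl | hpos
    · exact ⟨.nil, fun hr => (h.depth_zone 0 (by omega)).symm⟩
    · have hlt := h.parent_lt i hpos (by omega)
      obtain ⟨w, hw⟩ := ih (σ.parent i) hlt (by omega)
      refine ⟨.cons (underlying_adj.2 ⟨?_, Or.inl rfl⟩) w, fun hr => ?_⟩
      · intro he
        have := congrArg Fin.val he
        simp only at this
        omega
      · rw [SimpleGraph.Walk.length_cons, hw hr]
        exact (h.depth_parent i (by omega) (by omega)).symm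

theorem Layered.Valid.connected {r s : ℕ} {σ : Layered} (h : σ.Valid r s) (hn : n ≤ s + 1)
    (h0 : 0 < n) : (underlying n σ.graph).Connected := by
  have : Nonempty (Fin n) := ⟨⟨0, h0⟩⟩
  refine ⟨fun i j => ?_⟩
  obtain ⟨w, -⟩ := h.exists_walk_zero hn h0 i
  obtain ⟨w', -⟩ := h.exists_walk_zero hn h0 j
  exact ⟨w.append w'.reverse⟩

theorem Layered.Valid.diam_le {s : ℕ} {σ : Layered} (h : σ.Valid 0 s) (hn : n ≤ s + 1)
    (h0 : 0 < n) {b : ℕ} (hb : ∀ i < n, σ.depth i ≤ b) : (underlying n σ.graph).diam ≤ 2 * b := by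
  have : Nonempty (Fin n) := ⟨⟨0, h0⟩⟩
  obtain ⟨i, j, hij⟩ := (underlying n σ.graph).exists_dist_eq_diam
  obtain ⟨w, hw⟩ := h.exists_walk_zero hn h0 i
  obtain ⟨w', hw'⟩ := h.exists_walk_zero hn h0 j
  have := SimpleGraph.dist_le (w.append w'.reverse)
  rw [SimpleGraph.Walk.length_append, SimpleGraph.Walk.length_reverse, hw rfl, hw' rfl] at this
  have h1 := hb i i.2
  have h2 := hb j j.2
  omega

/-- The depth, with a sign that depends on the colour. -/
def Layered.signedDepth (σ : Layered) (i : ℕ) : ℤ :=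
  if σ.color i then (σ.depth i : ℤ) else -(σ.depth i : ℤ)

/-- An edge joins different colours only if its upper end has depth `0`, where the sign is
irrelevant. -/
theorem Layered.Valid.abs_signedDepth_sub_parent {r s : ℕ} {σ : Layered} (h : σ.Valid r s) {i : ℕ}
    (hi : i ≤ s) : |σ.signedDepth i - σ.signedDepth (σ.parent i)| ≤ 1 := by
  unfold signedDepth
  by_cases hr : i ≤ r
  · rw [h.depth_zone i hr, h.depth_zone _ ((h.parent_le hi).trans hr)]
    simp
  · have hd := h.depth_parent i (by omega) hi
    by_cases h0 : σ.depth (σ.parent i) = 0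
    · rw [hd, h0]
      split_ifs <;> simp
    · rw [h.color_parent i hi h0, hd]
      split_ifs <;> simp

theorem Layered.Valid.abs_signedDepth_sub_le {r s : ℕ} {σ : Layered} (h : σ.Valid r s)
    (hn : n ≤ s + 1) {i j : Fin n} (w : (underlying n σ.graph).Walk i j) :
    |σ.signedDepth i - σ.signedDepth j| ≤ w.length := by
  induction w with
  | nil => simp
  | @cons a b c hab w ih =>
    have hstep : |σ.signedDepth a - σ.signedDepth b| ≤ 1 := by
      obtain ⟨-, hp | hp⟩ := underlying_adj.1 hab
      · rw [← hp]
        exact h.abs_signedDepth_sub_parent (by omega)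
      · rw [← hp, abs_sub_comm]
        exact h.abs_signedDepth_sub_parent (by omega)
    have := abs_sub_le (σ.signedDepth a) (σ.signedDepth b) (σ.signedDepth c)
    rw [SimpleGraph.Walk.length_cons]
    push_cast
    linarith

theorem Layered.Valid.add_depth_le_diam {r s : ℕ} {σ : Layered} (h : σ.Valid r s)
    (hn : n ≤ s + 1) {i j : ℕ} (hi : i < n) (hj : j < n) (hci : σ.color i = true)
    (hcj : σ.color j = false) : σ.depth i + σ.depth j ≤ (underlying n σ.graph).diam := by
  have h0 : 0 < n := by omega
  have : Nonempty (Fin n) := ⟨⟨0, h0⟩⟩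
  have hconn := h.connected hn h0
  obtain ⟨w, hw⟩ := hconn.exists_walk_length_eq_dist ⟨i, hi⟩ ⟨j, hj⟩
  have h1 := h.abs_signedDepth_sub_le hn w
  have h2 := SimpleGraph.dist_le_diam (SimpleGraph.connected_iff_ediam_ne_top.1 hconn)
    (u := ⟨i, hi⟩) (v := ⟨j, hj⟩)
  simp only [signedDepth, hci, hcj] at h1
  have h3 := (abs_le.1 h1).2
  simp at h3
  omega

end Distance

/-! ### The displacement operator -/

/-- The expectation of `h (x + 1 - X)` for a geometric variable `X`. -/
noncomputable def displace (p : ℝ) (h : ℝ → ℝ) (x : ℝ) : ℝ :=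
  ∑' k : ℕ, (1 - p) ^ k * p * h (x + 1 - k)

/-- The exponential moment `E exp (θ (1 - X))` of the displacement. -/
noncomputable def expMoment (p θ : ℝ) : ℝ := p * Real.exp (2 * θ) / (Real.exp θ - (1 - p))

section Displace

variable {p : ℝ}

theorem geo_weight_nonneg (hp : p ∈ Set.Ioo (0 : ℝ) 1) (k : ℕ) : 0 ≤ (1 - p) ^ k * p :=
  mul_nonneg (pow_nonneg (by linarith [hp.2]) k) hp.1.le

theorem hasSum_geo_weight (hp : p ∈ Set.Ioo (0 : ℝ) 1) :
    HasSum (fun k : ℕ => (1 - p) ^ k * p) 1 := by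
  have := (hasSum_geometric_of_lt_one (r := 1 - p) (by linarith [hp.2])
    (by linarith [hp.1])).mul_right p
  rwa [show (1 - (1 - p))⁻¹ * p = 1 by rw [sub_sub_cancel, inv_mul_cancel₀ hp.1.ne']] at this

theorem summable_geo_weight_mul (hp : p ∈ Set.Ioo (0 : ℝ) 1) {f : ℕ → ℝ} {b : ℝ}
    (h0 : ∀ k, 0 ≤ f k) (hb : ∀ k, f k ≤ b) : Summable fun k => (1 - p) ^ k * p * f k :=
  Summable.of_nonneg_of_le (fun k => mul_nonneg (geo_weight_nonneg hp k) (h0 k))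
    (fun k => mul_le_mul_of_nonneg_left (hb k) (geo_weight_nonneg hp k))
    ((hasSum_geo_weight hp).summable.mul_right b)

theorem sub_pos_of_nonneg (hp : p ∈ Set.Ioo (0 : ℝ) 1) {θ : ℝ} (hθ : 0 ≤ θ) :
    0 < Real.exp θ - (1 - p) := by
  linarith [Real.one_le_exp hθ, hp.1]

theorem expMoment_pos (hp : p ∈ Set.Ioo (0 : ℝ) 1) {θ : ℝ} (hθ : 0 ≤ θ) : 0 < expMoment p θ :=
  div_pos (mul_pos hp.1 (Real.exp_pos _)) (sub_pos_of_nonneg hp hθ)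

theorem hasSum_displace_exp (hp : p ∈ Set.Ioo (0 : ℝ) 1) {θ : ℝ} (hθ : 0 ≤ θ) (x : ℝ) :
    HasSum (fun k : ℕ => (1 - p) ^ k * p * Real.exp (θ * (x + 1 - k)))
      (expMoment p θ * Real.exp (θ * x)) := by
  have hpos := sub_pos_of_nonneg hp hθ
  have hr : (1 - p) * Real.exp (-θ) < 1 := by
    rw [Real.exp_neg, ← div_eq_mul_inv, div_lt_one (Real.exp_pos _)]
    linarith
  have := (hasSum_geometric_of_lt_one
    (mul_nonneg (by linarith [hp.2]) (Real.exp_pos (-θ)).le) hr).mul_right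
      (p * Real.exp (θ * (x + 1)))
  have hv : (1 - (1 - p) * Real.exp (-θ))⁻¹ * (p * Real.exp (θ * (x + 1))) =
      expMoment p θ * Real.exp (θ * x) := by
    have : 1 - (1 - p) * (Real.exp θ)⁻¹ = (Real.exp θ - (1 - p)) / Real.exp θ := by
      field_simp
    rw [expMoment, Real.exp_neg, this, mul_add, mul_one, Real.exp_add, two_mul, Real.exp_add]
    field_simp
  rw [hv] at this
  have hf : ∀ k : ℕ, ((1 - p) * Real.exp (-θ)) ^ k * (p * Real.exp (θ * (x + 1))) =
      (1 - p) ^ k * p * Real.exp (θ * (x + 1 - k)) := fun k => by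
    rw [mul_pow, ← Real.exp_nat_mul, show θ * (x + 1 - k) = k * -θ + θ * (x + 1) by ring,
      Real.exp_add]
    ring
  simpa only [hf] using this

/-! ### Backward evolution of monotone profiles -/

/-- `h` is a monotone function with values in `[0, b]`. -/
structure IsProfile (b : ℝ) (h : ℝ → ℝ) : Prop where
  mono : Monotone h
  nonneg : ∀ x, 0 ≤ h x
  le : ∀ x, h x ≤ b

theorem IsProfile.summable {b : ℝ} {h : ℝ → ℝ} (hh : IsProfile b h)
    (hp : p ∈ Set.Ioo (0 : ℝ) 1) (x : ℝ) :
    Summable fun k : ℕ => (1 - p) ^ k * p * h (x + 1 - k) :=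
  summable_geo_weight_mul hp (fun _ => hh.nonneg _) fun _ => hh.le _

theorem IsProfile.displace {b : ℝ} {h : ℝ → ℝ} (hh : IsProfile b h)
    (hp : p ∈ Set.Ioo (0 : ℝ) 1) : IsProfile b (displace p h) := by
  refine ⟨fun x y hxy => ?_, fun x => ?_, fun x => ?_⟩
  · refine (hh.summable hp x).tsum_le_tsum (fun k => ?_) (hh.summable hp y)
    exact mul_le_mul_of_nonneg_left (hh.mono (by linarith)) (geo_weight_nonneg hp k)
  · exact tsum_nonneg fun k => mul_nonneg (geo_weight_nonneg hp k) (hh.nonneg _)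
  · have := (hasSum_geo_weight hp).mul_right b
    rw [one_mul] at this
    refine (hh.summable hp x).tsum_le_of_sum_le fun t => ?_
    refine le_trans (Finset.sum_le_sum fun k _ =>
      mul_le_mul_of_nonneg_left (hh.le _) (geo_weight_nonneg hp k)) ?_
    refine sum_le_hasSum t (fun k _ => mul_nonneg (geo_weight_nonneg hp k) ?_) this
    exact (hh.nonneg x).trans (hh.le x)

/-- The backward evolution of a profile over the arrival of `v_{s+1}`, with damping `κ`. -/
noncomputable def evolve (p κ : ℝ) (s : ℕ) (h : ℝ → ℝ) (x : ℝ) : ℝ :=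
  h x + κ / (s + 1) * displace p h x

/-- The backward evolution of a profile over the arrivals of `v_{s+1}, …, v_{s+j}`. -/
noncomputable def evolves (p κ : ℝ) (h : ℝ → ℝ) : ℕ → ℕ → ℝ → ℝ
  | 0, _ => h
  | j + 1, s => evolve p κ s (evolves p κ h j (s + 1))

variable {κ : ℝ}

theorem IsProfile.evolve {b : ℝ} {h : ℝ → ℝ} (hh : IsProfile b h) (hp : p ∈ Set.Ioo (0 : ℝ) 1)
    (hκ : κ ∈ Set.Icc (0 : ℝ) 1) (s : ℕ) :
    IsProfile (b * ((s + 2) / (s + 1))) (evolve p κ s h) := by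
  have hd := hh.displace hp
  have h1 : 0 ≤ κ / ((s : ℝ) + 1) := div_nonneg hκ.1 (by positivity)
  have h2 : κ / ((s : ℝ) + 1) ≤ 1 / (s + 1) := by
    gcongr
    exact hκ.2
  refine ⟨fun x y hxy => ?_, fun x => ?_, fun x => ?_⟩
  · exact add_le_add (hh.mono hxy) (mul_le_mul_of_nonneg_left (hd.mono hxy) h1)
  · exact add_nonneg (hh.nonneg x) (mul_nonneg h1 (hd.nonneg x))
  · have h3 : κ / ((s : ℝ) + 1) * RandomSurfer.displace p h x ≤ 1 / (s + 1) * b :=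
      mul_le_mul h2 (hd.le x) (hd.nonneg x) (by positivity)
    have h4 : b * (((s : ℝ) + 2) / (s + 1)) = b + 1 / (s + 1) * b := by
      field_simp
      ring
    rw [h4]
    exact add_le_add (hh.le x) h3

theorem IsProfile.evolves {b : ℝ} {h : ℝ → ℝ} (hh : IsProfile b h) (hp : p ∈ Set.Ioo (0 : ℝ) 1)
    (hκ : κ ∈ Set.Icc (0 : ℝ) 1) (j s : ℕ) :
    IsProfile (b * ((s + j + 1) / (s + 1))) (evolves p κ h j s) := by
  induction j generalizing s with
  | zero =>
    have : ((s : ℝ) + (0 : ℕ) + 1) / (s + 1) = 1 := by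
      rw [Nat.cast_zero, add_zero, div_self (by positivity)]
    rw [this, mul_one]
    exact hh
  | succ j ih =>
    have := (ih (s + 1)).evolve hp hκ s
    have hc : b * (((s + 1 : ℕ) + (j : ℝ) + 1) / ((s + 1 : ℕ) + 1)) * (((s : ℝ) + 2) / (s + 1)) =
        b * (((s : ℝ) + (j + 1 : ℕ) + 1) / (s + 1)) := by
      push_cast
      field_simp
      ring
    rwa [hc] at this

theorem IsProfile.le_evolves {b : ℝ} {h : ℝ → ℝ} (hh : IsProfile b h)
    (hp : p ∈ Set.Ioo (0 : ℝ) 1) (hκ : κ ∈ Set.Icc (0 : ℝ) 1) (j s : ℕ) (x : ℝ) :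
    h x ≤ RandomSurfer.evolves p κ h j s x := by
  induction j generalizing s with
  | zero => exact le_rfl
  | succ j ih =>
    refine (ih (s + 1)).trans (le_add_of_nonneg_right (mul_nonneg ?_ ?_))
    · exact div_nonneg hκ.1 (by positivity)
    · exact ((hh.evolves hp hκ j (s + 1)).displace hp).nonneg x

/-! ### Exponential lower bounds and power-law growth -/

/-- The factor by which an exponential with moment `a` grows over the arrivals of
`v_{s+1}, …, v_{s+j}`. -/
noncomputable def growth (a : ℝ) (s j : ℕ) : ℝ := ∏ i ∈ Finset.range j, (1 + a / (s + i + 1))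

theorem growth_succ (a : ℝ) (s j : ℕ) :
    growth a s (j + 1) = (1 + a / (s + 1)) * growth a (s + 1) j := by
  rw [growth, Finset.prod_range_succ', mul_comm, growth]
  congr 1
  · simp
  · refine Finset.prod_congr rfl fun i _ => ?_
    push_cast
    rw [add_right_comm (s : ℝ) 1 i, add_assoc (s : ℝ) (i : ℝ) 1]

/-- Exponentials are eigenfunctions of `displace p` and the evolution preserves order, so a minorant
made of three exponentials evolves explicitly, even though it is not itself a profile. -/
theorem evolves_ge_of_ge {b : ℝ} {h : ℝ → ℝ} (hh : IsProfile b h) (hp : p ∈ Set.Ioo (0 : ℝ) 1)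
    (hκ : κ ∈ Set.Icc (0 : ℝ) 1) {α β γ θ₀ θ₁ θ₂ : ℝ} (h0 : 0 ≤ θ₀) (h1 : 0 ≤ θ₁) (h2 : 0 ≤ θ₂)
    (hle : ∀ x, α * Real.exp (θ₀ * x) - β * Real.exp (θ₁ * x) - γ * Real.exp (θ₂ * x) ≤ h x)
    (j s : ℕ) (x : ℝ) :
    α * growth (κ * expMoment p θ₀) s j * Real.exp (θ₀ * x) -
      β * growth (κ * expMoment p θ₁) s j * Real.exp (θ₁ * x) -
      γ * growth (κ * expMoment p θ₂) s j * Real.exp (θ₂ * x) ≤ evolves p κ h j s x := by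
  induction j generalizing s x with
  | zero => simpa [growth, evolves] using hle x
  | succ j ih =>
    have hb := hh.evolves hp hκ j (s + 1)
    set f := evolves p κ h j (s + 1) with hf
    set A := α * growth (κ * expMoment p θ₀) (s + 1) j
    set B := β * growth (κ * expMoment p θ₁) (s + 1) j
    set C := γ * growth (κ * expMoment p θ₂) (s + 1) j
    have hd : A * (expMoment p θ₀ * Real.exp (θ₀ * x)) - B * (expMoment p θ₁ * Real.exp (θ₁ * x)) -
        C * (expMoment p θ₂ * Real.exp (θ₂ * x)) ≤ displace p f x := by
      have hsum := (((hasSum_displace_exp hp h0 x).mul_left A).sub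
        ((hasSum_displace_exp hp h1 x).mul_left B)).sub ((hasSum_displace_exp hp h2 x).mul_left C)
      refine hasSum_le (fun k => ?_) hsum (hb.summable hp x).hasSum
      have := mul_le_mul_of_nonneg_left (ih (s + 1) (x + 1 - k)) (geo_weight_nonneg hp k)
      refine le_trans (le_of_eq ?_) this
      ring
    have hk : 0 ≤ κ / ((s : ℝ) + 1) := div_nonneg hκ.1 (by positivity)
    have h3 := add_le_add (ih (s + 1) x) (mul_le_mul_of_nonneg_left hd hk)
    rw [growth_succ, growth_succ, growth_succ]
    refine le_trans (le_of_eq ?_) h3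
    simp only [A, B, C]
    ring

theorem growth_nonneg {a : ℝ} (ha : 0 ≤ a) (s j : ℕ) : 0 ≤ growth a s j :=
  Finset.prod_nonneg fun _ _ => by positivity

theorem growth_le {a : ℝ} (ha : 0 ≤ a) {s : ℕ} (hs : 0 < s) (j : ℕ) :
    growth a s j ≤ (((s : ℝ) + j) / s) ^ a := by
  have hs' : (0 : ℝ) < s := by exact_mod_cast hs
  induction j with
  | zero => simp [growth, hs'.ne']
  | succ j ih =>
    have hsj : (0 : ℝ) < s + j := by positivity
    rw [growth, Finset.prod_range_succ, ← growth]
    have h1 : ((s : ℝ) + (j + 1 : ℕ)) / s = ((s + j) / s) * ((s + j + 1) / (s + j)) := by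
      push_cast
      field_simp
      ring
    rw [h1, Real.mul_rpow (by positivity) (by positivity)]
    refine mul_le_mul ih ?_ (by positivity) (by positivity)
    rw [Real.rpow_def_of_pos (by positivity)]
    have h2 : 1 / ((s : ℝ) + j + 1) ≤ Real.log ((s + j + 1) / (s + j)) := by
      have := Real.one_sub_inv_le_log_of_pos (x := ((s : ℝ) + j + 1) / (s + j)) (by positivity)
      refine le_trans (le_of_eq ?_) this
      field_simp
      ring
    calc 1 + a / ((s : ℝ) + j + 1) = 1 / ((s : ℝ) + j + 1) * a + 1 := by ring
      _ ≤ Real.exp (1 / ((s : ℝ) + j + 1) * a) := Real.add_one_le_exp _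
      _ ≤ _ := Real.exp_le_exp.2 (mul_le_mul_of_nonneg_right h2 ha)

theorem le_growth {a : ℝ} (ha : 0 ≤ a) {r : ℕ} (hr : a ≤ r) (s j : ℕ) :
    (((s : ℝ) + j + 1 + r) / (s + 1 + r)) ^ a ≤ growth a s j := by
  induction j with
  | zero =>
    have : (0 : ℝ) < s + 1 + r := by positivity
    simp [growth, this.ne']
  | succ j ih =>
    rw [growth, Finset.prod_range_succ, ← growth]
    set t : ℝ := (s : ℝ) + j + 1 with ht
    have htp : 0 < t := by positivity
    have h1 : ((s : ℝ) + (j + 1 : ℕ) + 1 + r) / (s + 1 + r) =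
        ((t + r) / (s + 1 + r)) * ((t + r + 1) / (t + r)) := by
      rw [ht]
      push_cast
      field_simp
      ring
    rw [h1, Real.mul_rpow (by positivity) (by positivity)]
    refine mul_le_mul ih ?_ (by positivity) (growth_nonneg ha s j)
    have hr0 : (0 : ℝ) ≤ r := Nat.cast_nonneg r
    rw [Real.rpow_def_of_pos (by positivity)]
    have h2 : Real.log ((t + r + 1) / (t + r)) ≤ 1 / (t + r) := by
      have := Real.log_le_sub_one_of_pos (x := (t + r + 1) / (t + r)) (by positivity)
      refine this.trans (le_of_eq ?_)
      field_simp
      ring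
    -- The shift by `r ≥ a` absorbs the second-order loss in `log (1 + a / t) ≥ a / (t + a)`.
    have h3 : a / (t + r) ≤ Real.log (1 + a / t) := by
      have := Real.one_sub_inv_le_log_of_pos (x := 1 + a / t) (by positivity)
      refine le_trans ?_ this
      have : 1 - (1 + a / t)⁻¹ = a / (t + a) := by
        field_simp
        ring
      rw [this]
      gcongr
    rw [← Real.le_log_iff_exp_le (by positivity)]
    refine le_trans ?_ h3
    calc Real.log ((t + r + 1) / (t + r)) * a ≤ 1 / (t + r) * a :=
          mul_le_mul_of_nonneg_right h2 ha
      _ = a / (t + r) := by ring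

end Displace

/-! ### The Laplace functional of the coloured vertices -/

/-- The sum of `h (depth)` over the vertices of colour `b` among `v₀, …, vₛ`. -/
noncomputable def Layered.total (σ : Layered) (b : Bool) (h : ℝ → ℝ) (s : ℕ) : ℝ :=
  ∑ i ∈ Finset.range (s + 1), if σ.color i = b then h (σ.depth i) else 0

theorem Layered.total_step (σ : Layered) (b : Bool) (h : ℝ → ℝ) (s u x : ℕ) :
    (σ.step s u x).total b h (s + 1) =
      σ.total b h s + if σ.color u = b then h ((σ.depth u - x + 1 : ℕ) : ℝ) else 0 := by
  rw [total, Finset.sum_range_succ, total]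
  congr 1
  · refine Finset.sum_congr rfl fun i hi => ?_
    have : i ≠ s + 1 := (Finset.mem_range.1 hi).ne
    simp [step, Function.update_of_ne this]
  · simp [step]

theorem Layered.total_mono (σ : Layered) (b : Bool) {h h' : ℝ → ℝ} (hh : ∀ x, h x ≤ h' x)
    (s : ℕ) : σ.total b h s ≤ σ.total b h' s := by
  refine Finset.sum_le_sum fun i _ => ?_
  split_ifs
  exacts [hh _, le_rfl]

theorem Layered.total_evolve (σ : Layered) (b : Bool) (p κ : ℝ) (h : ℝ → ℝ) (s : ℕ) :
    σ.total b (evolve p κ s h) s =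
      σ.total b h s + κ * (σ.total b (displace p h) s / (s + 1)) := by
  simp only [total, evolve, Finset.sum_div, Finset.mul_sum, ← Finset.sum_add_distrib]
  refine Finset.sum_congr rfl fun i _ => ?_
  split_ifs
  · ring
  · simp

section Laplace

variable {p κ b₀ : ℝ}

/-- Truncation at the zone only increases depth. As `h` is monotone, dropping it weakens the
functional in the right direction, and the linear bound on `exp (-y)` then brings in `displace`. -/
theorem mean_geo_exp_neg_le (hp : p ∈ Set.Ioo (0 : ℝ) 1) {h : ℝ → ℝ} (hh : IsProfile b₀ h)
    (hexp : ∀ y ∈ Set.Icc 0 b₀, Real.exp (-y) ≤ 1 - κ * y) (d : ℕ) :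
    mean (geo p (Set.Ioo_subset_Ioc_self hp))
        (fun x => ENNReal.ofReal (Real.exp (-h ((d - x + 1 : ℕ) : ℝ)))) ≤
      ENNReal.ofReal (1 - κ * displace p h d) := by
  rw [mean_geo_ofReal p _ (fun k => (Real.exp_pos _).le)]
  · refine ENNReal.ofReal_le_ofReal ?_
    have hsum := (hasSum_geo_weight hp).sub ((hh.summable hp d).hasSum.mul_left κ)
    refine hasSum_le (fun k => ?_) (Summable.hasSum ?_) hsum
    · have h1 : h ((d : ℝ) + 1 - k) ≤ h ((d - k + 1 : ℕ) : ℝ) := by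
        refine hh.mono ?_
        push_cast
        have : (d : ℝ) - k ≤ ((d - k : ℕ) : ℝ) := by
          rw [sub_le_iff_le_add]
          exact_mod_cast Nat.sub_le_iff_le_add.1 le_rfl
        linarith
      have h2 := hexp (h ((d : ℝ) + 1 - k)) ⟨hh.nonneg _, hh.le _⟩
      have h3 := Real.exp_le_exp.2 (neg_le_neg h1)
      have h4 := mul_le_mul_of_nonneg_left (h3.trans h2) (geo_weight_nonneg hp k)
      refine h4.trans (le_of_eq ?_)
      ring
    · exact summable_geo_weight_mul hp (fun _ => (Real.exp_pos _).le)
        (fun k => Real.exp_le_one_iff.2 (neg_nonpos.2 (hh.nonneg _)))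
  · exact summable_geo_weight_mul hp (fun _ => (Real.exp_pos _).le)
      (fun k => Real.exp_le_one_iff.2 (neg_nonpos.2 (hh.nonneg _)))

/-- Since the newcomer takes the colour of the uniform vertex `u`, the average over `u` involves
only vertices of colour `b`. It gives `1 - κ * total / (s + 1)`, which is at most the exponential of
the added term. -/
theorem mean_stepLaw_exp_neg_total_le (hp : p ∈ Set.Ioo (0 : ℝ) 1) {h : ℝ → ℝ}
    (hh : IsProfile b₀ h) (hexp : ∀ y ∈ Set.Icc 0 b₀, Real.exp (-y) ≤ 1 - κ * y) (b : Bool)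
    (s : ℕ) (σ : Layered) :
    mean (stepLaw p (Set.Ioo_subset_Ioc_self hp) s σ)
        (fun τ => ENNReal.ofReal (Real.exp (-τ.total b h (s + 1)))) ≤
      ENNReal.ofReal (Real.exp (-σ.total b (evolve p κ s h) s)) := by
  have hnn : ∀ u : ℕ, 0 ≤ 1 - κ * (if σ.color u = b then displace p h (σ.depth u) else 0) := by
    intro u
    have hd := hh.displace hp
    split_ifs
    · exact (Real.exp_pos _).le.trans (hexp _ ⟨hd.nonneg _, hd.le _⟩)
    · simp
  have hu : ∀ u : ℕ, mean ((geo p (Set.Ioo_subset_Ioc_self hp)).map fun x => σ.step s u x)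
        (fun τ => ENNReal.ofReal (Real.exp (-τ.total b h (s + 1)))) ≤
      ENNReal.ofReal (Real.exp (-σ.total b h s)) *
        ENNReal.ofReal (1 - κ * (if σ.color u = b then displace p h (σ.depth u) else 0)) := by
    intro u
    rw [mean_map]
    simp only [Function.comp_def, Layered.total_step, neg_add, Real.exp_add,
      ENNReal.ofReal_mul (Real.exp_pos _).le]
    rw [mean_mul_left]
    refine mul_le_mul_right ?_ _
    split_ifs
    · exact mean_geo_exp_neg_le hp hh hexp _
    · simp [mean_const]
  rw [stepLaw, mean_bind, mean_uniformOfFintype_fin]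
  calc _ ≤ (∑ u : Fin (s + 1), ENNReal.ofReal (Real.exp (-σ.total b h s)) * ENNReal.ofReal
          (1 - κ * (if σ.color u = b then displace p h (σ.depth u) else 0))) *
            ((s : ℝ≥0∞) + 1)⁻¹ := by
        exact mul_le_mul_left (Finset.sum_le_sum fun (u : Fin (s + 1)) _ => hu u) _
    _ = ENNReal.ofReal (Real.exp (-σ.total b h s) *
          (1 - κ * (σ.total b (displace p h) s / (s + 1)))) := by
        have hs : ((s : ℝ≥0∞) + 1)⁻¹ = ENNReal.ofReal ((s : ℝ) + 1)⁻¹ := by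
          rw [ENNReal.ofReal_inv_of_pos (by positivity), ENNReal.ofReal_add (by positivity)
            zero_le_one, ENNReal.ofReal_natCast, ENNReal.ofReal_one]
        rw [← Finset.mul_sum, ← ENNReal.ofReal_sum_of_nonneg fun (u : Fin (s + 1)) _ => hnn u, hs,
          ← ENNReal.ofReal_mul (Real.exp_pos _).le, ← ENNReal.ofReal_mul
            (mul_nonneg (Real.exp_pos _).le (Finset.sum_nonneg fun (u : Fin (s + 1)) _ => hnn u))]
        congr 1
        have ht : σ.total b (displace p h) s = ∑ i : Fin (s + 1),
            if σ.color i = b then displace p h (σ.depth i) else 0 := Finset.sum_range _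
        rw [Finset.sum_sub_distrib, ← Finset.mul_sum, ht]
        simp
        field_simp
    _ ≤ _ := by
        refine ENNReal.ofReal_le_ofReal ?_
        rw [Layered.total_evolve, neg_add, Real.exp_add]
        refine mul_le_mul_of_nonneg_left ?_ (Real.exp_pos _).le
        exact Real.one_sub_le_exp_neg _

theorem mean_layeredLaw_exp_neg_total_le (hp : p ∈ Set.Ioo (0 : ℝ) 1)
    (hκ : κ ∈ Set.Icc (0 : ℝ) 1) {b₁ : ℝ} {h : ℝ → ℝ} (hh : IsProfile b₁ h) (b : Bool) (r : ℕ)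
    (c : ℕ → Bool) (j k : ℕ) (hb : b₁ * ((r + k + j + 1) / (r + k + 1)) ≤ b₀)
    (hexp : ∀ y ∈ Set.Icc 0 b₀, Real.exp (-y) ≤ 1 - κ * y) :
    mean (layeredLaw p (Set.Ioo_subset_Ioc_self hp) r c (k + j))
        (fun τ => ENNReal.ofReal (Real.exp (-τ.total b h (r + k + j)))) ≤
      mean (layeredLaw p (Set.Ioo_subset_Ioc_self hp) r c k)
        (fun τ => ENNReal.ofReal (Real.exp (-τ.total b (evolves p κ h j (r + k)) (r + k)))) := by
  induction j generalizing k with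
  | zero => exact le_rfl
  | succ j ih =>
    have hb0 : 0 ≤ b₁ := (hh.nonneg 0).trans (hh.le 0)
    have hb' : b₁ * (((r + k + 1 : ℕ) + j + 1) / ((r + k + 1 : ℕ) + 1)) ≤ b₀ := by
      refine le_trans (mul_le_mul_of_nonneg_left ?_ hb0) hb
      push_cast
      rw [show (r : ℝ) + k + 1 + j + 1 = r + k + (j + 1) + 1 by ring]
      exact div_le_div_of_nonneg_left (by positivity) (by positivity) (by linarith)
    have hprof : IsProfile b₀ (evolves p κ h j (r + k + 1)) := by
      have := hh.evolves hp hκ j (r + k + 1)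
      exact ⟨this.mono, this.nonneg, fun x => (this.le x).trans hb'⟩
    have h1 := ih (k + 1) (by
      refine le_trans (le_of_eq ?_) hb'
      push_cast
      ring)
    rw [show k + (j + 1) = k + 1 + j by ring, show r + k + (j + 1) = r + (k + 1) + j by ring]
    refine h1.trans ?_
    rw [layeredLaw, mean_bind]
    exact mean_mono fun σ _ => mean_stepLaw_exp_neg_total_le hp hprof hexp b (r + k) σ

end Laplace

/-! ### The constants -/

section Constants

variable {p : ℝ}

theorem isSurferS_surferS (hp : p ∈ Set.Ioo (0 : ℝ) 1) : IsSurferS p (surferS p hp) :=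
  (existsUnique_isSurferS p hp).choose_spec.1

theorem exp_one_div_surferS (hp : p ∈ Set.Ioo (0 : ℝ) 1) :
    Real.exp (1 / surferS p hp) = (1 - p) * (2 - surferS p hp) / (1 - surferS p hp) := by
  obtain ⟨⟨h0, h1⟩, h2⟩ := isSurferS_surferS hp
  rw [eq_div_of_mul_eq h0.ne' ((mul_comm _ _).trans h2) |>.symm, Real.exp_log]
  exact div_pos (mul_pos (by linarith [hp.2]) (by linarith)) (by linarith)

/-- The derivative of the logarithm of `expMoment p`. -/
noncomputable def expMomentLogDeriv (p θ : ℝ) : ℝ := 2 - Real.exp θ / (Real.exp θ - (1 - p))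

theorem hasDerivAt_expMoment (hp : p ∈ Set.Ioo (0 : ℝ) 1) {θ : ℝ} (hθ : 0 ≤ θ) :
    HasDerivAt (expMoment p) (expMoment p θ * expMomentLogDeriv p θ) θ := by
  have hpos := sub_pos_of_nonneg hp hθ
  have h1 : HasDerivAt (fun t : ℝ => p * Real.exp (2 * t)) (p * (Real.exp (2 * θ) * 2)) θ := by
    have := ((hasDerivAt_id θ).const_mul 2).exp.const_mul p
    simpa using this
  have h2 : HasDerivAt (fun t : ℝ => Real.exp t - (1 - p)) (Real.exp θ) θ :=
    (Real.hasDerivAt_exp θ).sub_const _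
  have h3 := h1.div h2 hpos.ne'
  have he : expMoment p θ * expMomentLogDeriv p θ =
      (p * (Real.exp (2 * θ) * 2) * (Real.exp θ - (1 - p)) - p * Real.exp (2 * θ) * Real.exp θ) /
        (Real.exp θ - (1 - p)) ^ 2 := by
    rw [expMoment, expMomentLogDeriv]
    field_simp
  rw [he]
  exact h3

theorem continuousAt_expMomentLogDeriv (hp : p ∈ Set.Ioo (0 : ℝ) 1) {θ : ℝ} (hθ : 0 ≤ θ) :
    ContinuousAt (expMomentLogDeriv p) θ := by
  unfold expMomentLogDeriv
  refine continuousAt_const.sub (ContinuousAt.div ?_ ?_ (sub_pos_of_nonneg hp hθ).ne')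
  · exact Real.continuous_exp.continuousAt
  · exact (Real.continuous_exp.sub continuous_const).continuousAt

theorem expMomentLogDeriv_le (hp : p ∈ Set.Ioo (0 : ℝ) 1) {θ θ' : ℝ} (hθ : 0 ≤ θ)
    (h : θ ≤ θ') : expMomentLogDeriv p θ ≤ expMomentLogDeriv p θ' := by
  have h1 := sub_pos_of_nonneg hp hθ
  have h2 := sub_pos_of_nonneg hp (hθ.trans h)
  have h3 := Real.exp_le_exp.2 h
  unfold expMomentLogDeriv
  refine sub_le_sub_left ?_ _
  rw [div_le_div_iff₀ h2 h1]
  nlinarith [hp.2]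

/-- This is stationarity of `φ θ / θ` at `θ = 1 / s`: the logarithmic derivative of `φ` equals `1 /
θ` there. -/
theorem expMomentLogDeriv_one_div_surferS (hp : p ∈ Set.Ioo (0 : ℝ) 1) :
    expMomentLogDeriv p (1 / surferS p hp) = surferS p hp := by
  obtain ⟨⟨h0, h1⟩, -⟩ := isSurferS_surferS hp
  have hq : (1 - p) ≠ 0 := by linarith [hp.2]
  have h1' : 1 - surferS p hp ≠ 0 := by linarith
  rw [expMomentLogDeriv, exp_one_div_surferS]
  have : (1 - p) * (2 - surferS p hp) / (1 - surferS p hp) - (1 - p) =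
      (1 - p) / (1 - surferS p hp) := by
    field_simp
    ring
  rw [this]
  field_simp
  ring

theorem cL_eq (hp : p ∈ Set.Ioo (0 : ℝ) 1) :
    cL p hp = surferS p hp * expMoment p (1 / surferS p hp) := by
  obtain ⟨⟨h0, h1⟩, -⟩ := isSurferS_surferS hp
  have hq : (1 - p) ≠ 0 := by linarith [hp.2]
  have h1' : 1 - surferS p hp ≠ 0 := by linarith
  have h2 : Real.exp (2 * (1 / surferS p hp)) = Real.exp (1 / surferS p hp) ^ 2 := by
    rw [two_mul, Real.exp_add, sq]
  rw [cL, expMoment, h2, exp_one_div_surferS]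
  have : (1 - p) * (2 - surferS p hp) / (1 - surferS p hp) - (1 - p) =
      (1 - p) / (1 - surferS p hp) := by
    field_simp
    ring
  rw [this]
  field_simp

theorem cL_pos (hp : p ∈ Set.Ioo (0 : ℝ) 1) : 0 < cL p hp := by
  obtain ⟨⟨h0, h1⟩, -⟩ := isSurferS_surferS hp
  rw [cL_eq]
  exact mul_pos h0 (expMoment_pos hp (by positivity))

/-- For `θ` slightly below `1 / s` one has `l < φ' θ < φ θ / θ`. The gaps leave room for the damping
`κ` and for a slope `β`, and first-order expansion in `η` gives the last two inequalities. -/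
theorem exists_exponents (hp : p ∈ Set.Ioo (0 : ℝ) 1) {l : ℝ} (hl0 : 0 < l) (hl : l < cL p hp) :
    ∃ θ η β κ : ℝ, 0 < η ∧ η < θ ∧ 0 < κ ∧ κ < 1 ∧ θ * β < κ * expMoment p θ ∧
      κ * expMoment p (θ + η) - η * β < κ * expMoment p θ ∧
      κ * expMoment p (θ - η) + η * l < κ * expMoment p θ := by
  obtain ⟨⟨hs0, hs1⟩, -⟩ := isSurferS_surferS hp
  have hθs : 0 < 1 / surferS p hp := by positivity
  have hcont : ContinuousAt (fun θ => expMoment p θ * expMomentLogDeriv p θ)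
      (1 / surferS p hp) :=
    (hasDerivAt_expMoment hp hθs.le).continuousAt.mul (continuousAt_expMomentLogDeriv hp hθs.le)
  have hval : l < expMoment p (1 / surferS p hp) * expMomentLogDeriv p (1 / surferS p hp) := by
    rwa [expMomentLogDeriv_one_div_surferS, mul_comm, ← cL_eq]
  -- Left of `1 / s` the logarithmic derivative is at most `s < 1 / θ`, while `φ'` is still close to
  -- `φ' (1 / s) = c_L > l`.
  have hev : ∀ᶠ θ in 𝓝[<] (1 / surferS p hp),
      l < expMoment p θ * expMomentLogDeriv p θ ∧ 0 < θ ∧ θ < 1 / surferS p hp := by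
    filter_upwards [nhdsWithin_le_nhds (hcont.eventually (lt_mem_nhds hval)),
      nhdsWithin_le_nhds (lt_mem_nhds hθs), self_mem_nhdsWithin] with θ h1 h2 h3
    exact ⟨h1, h2, h3⟩
  obtain ⟨θ, h1, h2, h3⟩ := hev.exists
  set d := expMoment p θ * expMomentLogDeriv p θ with hd
  have hφ := expMoment_pos hp h2.le
  have hd0 : 0 < d := hl0.trans h1
  have hdφ : d < expMoment p θ / θ := by
    have h4 : expMomentLogDeriv p θ < 1 / θ := by
      refine (expMomentLogDeriv_le hp h2.le h3.le).trans_lt ?_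
      rw [expMomentLogDeriv_one_div_surferS, lt_div_iff₀ h2, mul_comm]
      exact (lt_div_iff₀ hs0).1 h3
    calc d < expMoment p θ * (1 / θ) := mul_lt_mul_of_pos_left h4 hφ
      _ = _ := by ring
  have hld : l / d < 1 := (div_lt_one hd0).2 h1
  -- The midpoint of `l / d` and `1`, so that `κ < 1` and still `l < κ * d`.
  set κ := (1 + l / d) / 2 with hκ
  have hκ0 : 0 < κ := by positivity
  have hκ1 : κ < 1 := by linarith
  have hκd : l < κ * d := by
    have : κ * d = (d + l) / 2 := by
      rw [hκ]
      field_simp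
    linarith
  -- The midpoint of `κ * d` and `κ * φ θ / θ`.
  set β := κ * ((d + expMoment p θ / θ) / 2) with hβ
  have hβ1 : κ * d < β := mul_lt_mul_of_pos_left (by linarith) hκ0
  have hβ2 : θ * β < κ * expMoment p θ := by
    have : β < κ * (expMoment p θ / θ) := mul_lt_mul_of_pos_left (by linarith) hκ0
    calc θ * β < θ * (κ * (expMoment p θ / θ)) := mul_lt_mul_of_pos_left this h2
      _ = _ := by field_simp
  have hder := hasDerivAt_expMoment hp h2.le
  have hr := ((hder.const_mul κ).tendsto_slope_zero_right).eventually (gt_mem_nhds hβ1)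
  have hder' : HasDerivAt (fun t => expMoment p (θ - t)) (-d) 0 := by
    refine HasDerivAt.comp_const_sub θ 0 ?_
    rwa [sub_zero]
  have hr' := ((hder'.const_mul κ).tendsto_slope_zero_right).eventually
    (gt_mem_nhds (show κ * -d < -l by linarith))
  have hsmall : ∀ᶠ η in 𝓝[>] (0 : ℝ), η < θ := nhdsWithin_le_nhds (gt_mem_nhds h2)
  have hposη : ∀ᶠ η in 𝓝[>] (0 : ℝ), 0 < η := self_mem_nhdsWithin
  obtain ⟨η, ⟨⟨e1, e2⟩, e3⟩, e4⟩ := (((hr.and hr').and hsmall).and hposη).exists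
  refine ⟨θ, η, β, κ, e4, e3, hκ0, hκ1, hβ2, ?_, ?_⟩
  · rw [smul_eq_mul, inv_mul_lt_iff₀ e4] at e1
    linarith
  · rw [smul_eq_mul, inv_mul_lt_iff₀ e4, zero_add, sub_zero] at e2
    linarith

end Constants

/-! ### Growth of a level set over one block of arrivals -/

/-- The profile that equals `c` on `[y, ∞)` and vanishes elsewhere. -/
noncomputable def level (c y x : ℝ) : ℝ := if y ≤ x then c else 0

theorem isProfile_level {c : ℝ} (hc : 0 ≤ c) (y : ℝ) : IsProfile c (level c y) := by
  refine ⟨fun a b hab => ?_, fun x => ?_, fun x => ?_⟩ <;> unfold level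
  · split_ifs with h1 h2
    exacts [le_rfl, absurd (h1.trans hab) h2, hc, le_rfl]
  · split_ifs
    exacts [hc, le_rfl]
  · split_ifs
    exacts [le_rfl, hc]

/-- The minorant is `c * exp (θ (x - b)) * (1 - exp (η (x - b)) - exp (η (a - x)))`. Its last factor
is nonpositive for `x ≥ b` and for `x ≤ a`; elsewhere the first exponential is at most `1`. -/
theorem exp_sub_exp_sub_exp_le_level {θ η : ℝ} (hη : 0 < η) (hθ : 0 ≤ θ) {c : ℝ} (hc : 0 ≤ c)
    (a b x : ℝ) :
    c * Real.exp (-(θ * b)) * Real.exp (θ * x) -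
      c * Real.exp (-(θ * b) - η * b) * Real.exp ((θ + η) * x) -
      c * Real.exp (-(θ * b) + η * a) * Real.exp ((θ - η) * x) ≤ level c a x := by
  have key : c * Real.exp (-(θ * b)) * Real.exp (θ * x) -
      c * Real.exp (-(θ * b) - η * b) * Real.exp ((θ + η) * x) -
      c * Real.exp (-(θ * b) + η * a) * Real.exp ((θ - η) * x) =
      c * (Real.exp (θ * (x - b)) * (1 - Real.exp (η * (x - b)) - Real.exp (η * (a - x)))) := by
    have e0 : Real.exp (-(θ * b)) * Real.exp (θ * x) = Real.exp (θ * (x - b)) := by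
      rw [← Real.exp_add]
      ring_nf
    have e1 : Real.exp (-(θ * b) - η * b) * Real.exp ((θ + η) * x) =
        Real.exp (θ * (x - b)) * Real.exp (η * (x - b)) := by
      rw [← Real.exp_add, ← Real.exp_add]
      ring_nf
    have e2 : Real.exp (-(θ * b) + η * a) * Real.exp ((θ - η) * x) =
        Real.exp (θ * (x - b)) * Real.exp (η * (a - x)) := by
      rw [← Real.exp_add, ← Real.exp_add]
      ring_nf
    rw [mul_assoc, mul_assoc, mul_assoc, e0, e1, e2]
    ring
  rw [key, level]
  have e1 := Real.exp_pos (η * (x - b))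
  have e2 := Real.exp_pos (η * (a - x))
  split_ifs with h
  · refine (mul_le_mul_of_nonneg_left ?_ hc).trans_eq (mul_one c)
    rcases le_total x b with hx | hx
    · have h1 : Real.exp (θ * (x - b)) ≤ 1 :=
        Real.exp_le_one_iff.2 (mul_nonpos_of_nonneg_of_nonpos hθ (by linarith))
      have h2 := Real.exp_pos (θ * (x - b))
      nlinarith
    · have h1 : 1 ≤ Real.exp (η * (x - b)) :=
        Real.one_le_exp (mul_nonneg hη.le (by linarith))
      have h2 := Real.exp_pos (θ * (x - b))
      nlinarith
  · have h1 : 1 ≤ Real.exp (η * (a - x)) := Real.one_le_exp (mul_nonneg hη.le (by linarith))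
    have h2 := Real.exp_pos (θ * (x - b))
    exact mul_nonpos_of_nonneg_of_nonpos hc (mul_nonpos_of_nonneg_of_nonpos h2.le (by linarith))

theorem eventually_exp_combination {a₀ a₁ a₂ c₀ c₁ c₂ : ℝ} (h0 : 0 < a₀) (h1 : a₁ < a₀)
    (h2 : a₂ < a₀) (hc : 0 < c₀) :
    ∀ᶠ t : ℝ in atTop,
      1 ≤ c₀ * Real.exp (a₀ * t) - c₁ * Real.exp (a₁ * t) - c₂ * Real.exp (a₂ * t) := by
  have hdecay : ∀ a < a₀, Tendsto (fun t : ℝ => Real.exp ((a - a₀) * t)) atTop (𝓝 0) :=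
    fun a ha => Real.tendsto_exp_atBot.comp (tendsto_id.const_mul_atTop_of_neg (by linarith))
  have hlim : Tendsto (fun t : ℝ => c₀ - c₁ * Real.exp ((a₁ - a₀) * t) -
      c₂ * Real.exp ((a₂ - a₀) * t)) atTop (𝓝 c₀) := by
    have := (((hdecay a₁ h1).const_mul c₁).const_sub c₀).sub ((hdecay a₂ h2).const_mul c₂)
    simpa using this
  have hexp : Tendsto (fun t : ℝ => Real.exp (a₀ * t)) atTop atTop :=
    Real.tendsto_exp_atTop.comp (tendsto_id.const_mul_atTop h0)
  filter_upwards [(hexp.atTop_mul_pos hc hlim).eventually_ge_atTop 1] with t ht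
  refine ht.trans_eq ?_
  have e : ∀ a, Real.exp (a * t) = Real.exp (a₀ * t) * Real.exp ((a - a₀) * t) := fun a => by
    rw [← Real.exp_add]
    ring_nf
  rw [e a₁, e a₂]
  ring

theorem exists_block {p : ℝ} (hp : p ∈ Set.Ioo (0 : ℝ) 1) {l : ℝ} (hl0 : 0 < l)
    (hl : l < cL p hp) :
    ∃ κ : ℝ, 0 < κ ∧ κ < 1 ∧ ∃ M : ℕ, 2 ≤ M ∧ ∀ (s j : ℕ), 0 < s → s + j + 1 = M * (s + 1) →
      ∀ c : ℝ, 0 ≤ c → ∀ y x : ℝ,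
        level c y x ≤ evolves p κ (level c (y + l * Real.log M)) j s x := by
  obtain ⟨θ, η, β, κ, hη, hηθ, hκ0, hκ1, h0, h1, h2⟩ := exists_exponents hp hl0 hl
  have hθ : 0 < θ := hη.trans hηθ
  set a₀ := κ * expMoment p θ with ha₀
  set a₁ := κ * expMoment p (θ + η) with ha₁
  set a₂ := κ * expMoment p (θ - η) with ha₂
  have p0 : 0 < a₀ := mul_pos hκ0 (expMoment_pos hp hθ.le)
  have p1 : 0 < a₁ := mul_pos hκ0 (expMoment_pos hp (by linarith))
  have p2 : 0 < a₂ := mul_pos hκ0 (expMoment_pos hp (by linarith))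
  obtain ⟨r, hr⟩ := exists_nat_ge a₀
  have hr1 : (0 : ℝ) < 1 + r := by positivity
  -- With `T = log M`, these are the exponents in `T` of the three evolved terms at `x = y`, for
  -- cut-offs at `y + l T` and `y + β T`. The choice of exponents makes the first one positive and
  -- dominant.
  have hev := eventually_exp_combination (a₀ := a₀ - θ * β) (a₁ := a₁ - η * β - θ * β)
    (a₂ := a₂ + η * l - θ * β) (c₀ := (1 / (1 + (r : ℝ))) ^ a₀) (c₁ := 2 ^ a₁) (c₂ := 2 ^ a₂)
    (by linarith) (by linarith) (by linarith) (by positivity)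
  obtain ⟨M, hM, hM2⟩ := (((Real.tendsto_log_atTop.comp tendsto_natCast_atTop_atTop).eventually
    hev).and (eventually_ge_atTop 2)).exists
  refine ⟨κ, hκ0, hκ1, M, hM2, fun s j hs hj c hc y x => ?_⟩
  have hκ : κ ∈ Set.Icc (0 : ℝ) 1 := ⟨hκ0.le, hκ1.le⟩
  have hM0 : (0 : ℝ) < M := by positivity
  have hs1 : (1 : ℝ) ≤ s := by exact_mod_cast hs
  have hj' : (s : ℝ) + j + 1 = M * (s + 1) := by exact_mod_cast hj
  set T := Real.log M with hT
  have hpow : ∀ a : ℝ, (M : ℝ) ^ a = Real.exp (a * T) := fun a => by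
    rw [Real.rpow_def_of_pos hM0, mul_comm]
  have hprof := isProfile_level hc (y + l * T)
  have hevp := hprof.evolves hp hκ j s
  by_cases hyx : y ≤ x
  swap
  · rw [level, if_neg hyx]
    exact hevp.nonneg x
  rw [level, if_pos hyx]
  -- By monotonicity only the value at the threshold `y` matters.
  refine le_trans ?_ (hevp.mono hyx)
  have hge := evolves_ge_of_ge hprof hp hκ hθ.le (by linarith : 0 ≤ θ + η)
    (by linarith : 0 ≤ θ - η)
    (exp_sub_exp_sub_exp_le_level hη hθ.le hc (y + l * T) (y + β * T)) j s y
  refine le_trans ?_ hge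
  rw [← ha₀, ← ha₁, ← ha₂]
  have g0 : (1 / (1 + (r : ℝ))) ^ a₀ * Real.exp (a₀ * T) ≤ growth a₀ s j := by
    refine le_trans ?_ (le_growth p0.le hr s j)
    rw [← hpow, ← Real.mul_rpow (by positivity) hM0.le]
    refine Real.rpow_le_rpow (by positivity) ?_ p0.le
    rw [hj', one_div_mul_eq_div, div_le_div_iff₀ hr1 (by positivity)]
    have : (0 : ℝ) ≤ r := Nat.cast_nonneg r
    nlinarith [mul_nonneg (mul_nonneg hM0.le this) (by linarith : (0 : ℝ) ≤ s)]
  -- The factor `2 ^ a` comes from `s + j ≤ M * (s + 1) ≤ 2 * M * s`; it does not depend on `s`, so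
  -- one `M` serves all blocks.
  have gub : ∀ a : ℝ, 0 < a → growth a s j ≤ 2 ^ a * Real.exp (a * T) := by
    intro a ha
    refine (growth_le ha.le hs j).trans ?_
    rw [← hpow, ← Real.mul_rpow (by positivity) hM0.le]
    refine Real.rpow_le_rpow (by positivity) ?_ ha.le
    rw [div_le_iff₀ (by linarith)]
    nlinarith
  have g1 := gub a₁ p1
  have g2 := gub a₂ p2
  have hM' : 1 ≤ (1 / (1 + (r : ℝ))) ^ a₀ * Real.exp ((a₀ - θ * β) * T) -
      2 ^ a₁ * Real.exp ((a₁ - η * β - θ * β) * T) -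
      2 ^ a₂ * Real.exp ((a₂ + η * l - θ * β) * T) := hM
  have key : ∀ G₀ G₁ G₂ : ℝ,
      c * Real.exp (-(θ * (y + β * T))) * G₀ * Real.exp (θ * y) -
        c * Real.exp (-(θ * (y + β * T)) - η * (y + β * T)) * G₁ * Real.exp ((θ + η) * y) -
        c * Real.exp (-(θ * (y + β * T)) + η * (y + l * T)) * G₂ * Real.exp ((θ - η) * y) =
      c * (Real.exp (-(θ * β * T)) * G₀ - Real.exp (-(θ * β * T) - η * β * T) * G₁ -
        Real.exp (-(θ * β * T) + η * l * T) * G₂) := by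
    intro G₀ G₁ G₂
    have e0 : Real.exp (-(θ * β * T)) =
        Real.exp (-(θ * (y + β * T))) * Real.exp (θ * y) := by
      rw [← Real.exp_add]
      ring_nf
    have e1 : Real.exp (-(θ * β * T) - η * β * T) =
        Real.exp (-(θ * (y + β * T)) - η * (y + β * T)) * Real.exp ((θ + η) * y) := by
      rw [← Real.exp_add]
      ring_nf
    have e2 : Real.exp (-(θ * β * T) + η * l * T) =
        Real.exp (-(θ * (y + β * T)) + η * (y + l * T)) * Real.exp ((θ - η) * y) := by
      rw [← Real.exp_add]
      ring_nf
    rw [e0, e1, e2]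
    ring
  rw [key]
  refine (mul_one c).symm.trans_le (mul_le_mul_of_nonneg_left (hM'.trans ?_) hc)
  refine sub_le_sub (sub_le_sub ?_ ?_) ?_
  · refine le_trans (le_of_eq ?_) (mul_le_mul_of_nonneg_left g0 (Real.exp_pos _).le)
    rw [mul_left_comm, ← Real.exp_add]
    ring_nf
  · refine (mul_le_mul_of_nonneg_left g1 (Real.exp_pos _).le).trans (le_of_eq ?_)
    rw [mul_left_comm, ← Real.exp_add]
    ring_nf
  · refine (mul_le_mul_of_nonneg_left g2 (Real.exp_pos _).le).trans (le_of_eq ?_)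
    rw [mul_left_comm, ← Real.exp_add]
    ring_nf

/-! ### Deep vertices of both colours -/

/-- From `exp (-y) ≤ 1 / (1 + y)`: the bound reduces to `0 ≤ y * (1 - κ - κ * y)`. -/
theorem exp_neg_le_one_sub_mul {κ : ℝ} (hκ0 : 0 < κ) (hκ1 : κ < 1) :
    ∀ y ∈ Set.Icc 0 (1 - κ), Real.exp (-y) ≤ 1 - κ * y := by
  rintro y ⟨hy0, hy1⟩
  have h1 := Real.add_one_le_exp y
  rw [Real.exp_neg, inv_le_comm₀ (Real.exp_pos _) (by nlinarith)]
  refine le_trans ?_ h1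
  rw [inv_le_iff_one_le_mul₀ (by nlinarith)]
  have h2 : 0 ≤ y * (1 - κ - κ * y) := mul_nonneg hy0 (by nlinarith)
  nlinarith

/-- The first half of the `2 m` zone vertices gets the colour `true`. -/
def halfColor (m i : ℕ) : Bool := decide (i < m)

theorem card_halfColor (m : ℕ) (hm : 0 < m) (b : Bool) :
    ((Finset.range (2 * m - 1 + 1)).filter fun i => halfColor m i = b).card = m := by
  have h2 : 2 * m - 1 + 1 = 2 * m := by omega
  rw [h2]
  cases b
  · have : ((Finset.range (2 * m)).filter fun i => halfColor m i = false) =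
        Finset.Ico m (2 * m) := by
      ext i
      simp [halfColor]
      omega
    rw [this, Nat.card_Ico]
    omega
  · have : ((Finset.range (2 * m)).filter fun i => halfColor m i = true) = Finset.range m := by
      ext i
      simp [halfColor]
      omega
    rw [this, Finset.card_range]

theorem exists_deep_of_color {p : ℝ} (hp : p ∈ Set.Ioo (0 : ℝ) 1) {l : ℝ} (hl0 : 0 < l)
    (hl : l < cL p hp) :
    ∃ c : ℝ, 0 < c ∧ ∃ M : ℕ, 2 ≤ M ∧ ∀ (m : ℕ), 0 < m → ∀ (b : Bool) (K k : ℕ),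
      M ^ K * (2 * m) ≤ 2 * m + k → 2 * m + k ≤ M ^ (K + 1) * (2 * m) →
      (layeredLaw p (Set.Ioo_subset_Ioc_self hp) (2 * m - 1) (halfColor m) k).toOuterMeasure
        {σ | ∀ i < 2 * m + k, σ.color i = b → (σ.depth i : ℝ) < K * (l * Real.log M)} ≤
        ENNReal.ofReal (Real.exp (-(c * m))) := by
  obtain ⟨κ, hκ0, hκ1, M, hM, hblock⟩ := exists_block hp hl0 hl
  have hκ : κ ∈ Set.Icc (0 : ℝ) 1 := ⟨hκ0.le, hκ1.le⟩
  have hM0 : (0 : ℝ) < M := by positivity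
  have hc0 : 0 < (1 - κ) / M := div_pos (by linarith) hM0
  -- Over one block a profile grows by a factor at most `M`. Height `(1 - κ) / M` keeps it in `[0, 1
  -- - κ]`, where the linear bound on `exp (-y)` holds.
  refine ⟨(1 - κ) / M, hc0, M, hM, fun m hm b K k hk1 hk2 => ?_⟩
  set c := (1 - κ) / M with hc
  have hexp := exp_neg_le_one_sub_mul hκ0 hκ1
  set r := 2 * m - 1 with hrdef
  have hr : 2 * m = r + 1 := by omega
  rw [hr] at hk1 hk2
  have hratio : ∀ k j : ℕ, r + k + j + 1 ≤ M * (r + k + 1) →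
      c * (((r : ℝ) + k + j + 1) / (r + k + 1)) ≤ 1 - κ := by
    intro k j hkj
    have h1 : ((r : ℝ) + k + j + 1) / (r + k + 1) ≤ M := by
      rw [div_le_iff₀ (by positivity)]
      exact_mod_cast hkj
    calc c * (((r : ℝ) + k + j + 1) / (r + k + 1)) ≤ c * M := mul_le_mul_of_nonneg_left h1 hc0.le
      _ = 1 - κ := by rw [hc]; field_simp
  have hblocks : ∀ K k : ℕ, r + k + 1 = M ^ K * (r + 1) →
      mean (layeredLaw p (Set.Ioo_subset_Ioc_self hp) r (halfColor m) k) (fun τ =>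
        ENNReal.ofReal (Real.exp (-τ.total b (level c (K * (l * Real.log M))) (r + k)))) ≤
        ENNReal.ofReal (Real.exp (-(c * m))) := by
    intro K
    induction K with
    | zero =>
      intro k hk
      obtain rfl : k = 0 := by
        rw [pow_zero, one_mul] at hk
        omega
      rw [layeredLaw, mean_map]
      refine le_trans (mean_mono (g := fun _ => ENNReal.ofReal (Real.exp (-(c * m))))
        fun g _ => ?_) (mean_const _ _).le
      refine ENNReal.ofReal_le_ofReal (Real.exp_le_exp.2 (neg_le_neg (le_of_eq ?_)))
      have hcard := card_halfColor m hm b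
      rw [Layered.total]
      simp only [Nat.cast_zero, zero_mul, level, le_refl, if_true, add_zero]
      rw [← Finset.sum_filter, Finset.sum_const, hcard, nsmul_eq_mul, mul_comm]
    | succ K ih =>
      intro k hk
      have hpos : 0 < M ^ K * (r + 1) := by positivity
      have hle : M ^ K ≥ 1 := Nat.one_le_pow _ _ (by omega)
      obtain ⟨k', hk'⟩ : ∃ k', r + k' + 1 = M ^ K * (r + 1) :=
        ⟨M ^ K * (r + 1) - (r + 1), by
          have := Nat.mul_le_mul_right (r + 1) hle
          omega⟩
      have hk3 : r + k + 1 = M * (r + k' + 1) := by rw [hk, hk', pow_succ]; ring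
      obtain ⟨j, rfl⟩ : ∃ j, k = k' + j := Nat.exists_eq_add_of_le (by nlinarith)
      refine le_trans ?_ (ih k' hk')
      simp only [← add_assoc]
      refine (mean_layeredLaw_exp_neg_total_le hp hκ (isProfile_level hc0.le _) b r (halfColor m)
        j k' (hratio k' j (by linarith)) hexp).trans (mean_mono fun σ _ => ?_)
      refine ENNReal.ofReal_le_ofReal (Real.exp_le_exp.2 (neg_le_neg ?_))
      refine σ.total_mono b (fun x => ?_) _
      have := hblock (r + k') j (by omega) (by linarith) c hc0.le (K * (l * Real.log M)) x
      rwa [show (K : ℝ) * (l * Real.log M) + l * Real.log M = (K + 1 : ℕ) * (l * Real.log M) by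
        push_cast; ring] at this
  have hle : M ^ K ≥ 1 := Nat.one_le_pow _ _ (by omega)
  obtain ⟨k', hk'⟩ : ∃ k', r + k' + 1 = M ^ K * (r + 1) :=
    ⟨M ^ K * (r + 1) - (r + 1), by
      have := Nat.mul_le_mul_right (r + 1) hle
      omega⟩
  -- The last `j` arrivals form an incomplete block. They need no gain, only that evolution never
  -- lowers a profile.
  obtain ⟨j, rfl⟩ : ∃ j, k = k' + j := Nat.exists_eq_add_of_le (by omega)
  have hkj : r + k' + j + 1 ≤ M * (r + k' + 1) := by
    rw [hk', ← mul_assoc, ← pow_succ']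
    omega
  refine (toOuterMeasure_le_mean _ fun σ _ hσ => ?_).trans
    ((mean_layeredLaw_exp_neg_total_le hp hκ (isProfile_level hc0.le (K * (l * Real.log M))) b r
      (halfColor m) j k' (hratio k' j hkj) hexp).trans (le_trans (mean_mono fun σ _ => ?_)
        (hblocks K k' hk')))
  · have h0 : σ.total b (level c (K * (l * Real.log M))) (r + k' + j) = 0 := by
      refine Finset.sum_eq_zero fun i hi => ?_
      split_ifs with hb
      · rw [level, if_neg]
        have := hσ i (by have := Finset.mem_range.1 hi; omega) hb
        linarith
      · rfl
    simp [h0]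
  · refine ENNReal.ofReal_le_ofReal (Real.exp_le_exp.2 (neg_le_neg ?_))
    exact σ.total_mono b (fun x => (isProfile_level hc0.le _).le_evolves hp hκ j _ x) _

/-! ### The exponential moment of the depths -/

/-- The sum of `exp (θ depth)` over `v₀, …, vₛ`. -/
noncomputable def Layered.expTotal (σ : Layered) (θ : ℝ) (s : ℕ) : ℝ :=
  ∑ i ∈ Finset.range (s + 1), Real.exp (θ * σ.depth i)

theorem Layered.expTotal_step (σ : Layered) (θ : ℝ) (s u x : ℕ) :
    (σ.step s u x).expTotal θ (s + 1) =
      σ.expTotal θ s + Real.exp (θ * (σ.depth u - x + 1 : ℕ)) := by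
  rw [expTotal, Finset.sum_range_succ, expTotal]
  congr 1
  · refine Finset.sum_congr rfl fun i hi => ?_
    have : i ≠ s + 1 := (Finset.mem_range.1 hi).ne
    simp [step, Function.update_of_ne this]
  · simp [step]

theorem Layered.expTotal_nonneg (σ : Layered) (θ : ℝ) (s : ℕ) : 0 ≤ σ.expTotal θ s :=
  Finset.sum_nonneg fun _ _ => (Real.exp_pos _).le

variable {p : ℝ}

/-- Walks with `x ≤ d` are covered by the untruncated moment; the others end at depth `1` and
contribute `exp θ`. -/
theorem mean_geo_exp_le (hp : p ∈ Set.Ioo (0 : ℝ) 1) {θ : ℝ} (hθ : 0 ≤ θ) (d : ℕ) :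
    mean (geo p (Set.Ioo_subset_Ioc_self hp))
        (fun x => ENNReal.ofReal (Real.exp (θ * (d - x + 1 : ℕ)))) ≤
      ENNReal.ofReal (Real.exp θ + expMoment p θ * Real.exp (θ * d)) := by
  have hle : ∀ x : ℕ, Real.exp (θ * (d - x + 1 : ℕ)) ≤ Real.exp (θ * (d + 1)) := fun x => by
    refine Real.exp_le_exp.2 (mul_le_mul_of_nonneg_left ?_ hθ)
    exact_mod_cast Nat.succ_le_succ (Nat.sub_le d x)
  have hsum := summable_geo_weight_mul hp (fun x : ℕ => (Real.exp_pos (θ * (d - x + 1 : ℕ))).le) hle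
  rw [mean_geo_ofReal p _ (fun k => (Real.exp_pos _).le) hsum]
  refine ENNReal.ofReal_le_ofReal ?_
  have h1 := ((hasSum_geo_weight hp).mul_right (Real.exp θ)).add (hasSum_displace_exp hp hθ d)
  rw [one_mul] at h1
  refine hasSum_le (fun k => ?_) hsum.hasSum h1
  rw [← mul_add]
  refine mul_le_mul_of_nonneg_left ?_ (geo_weight_nonneg hp k)
  rcases Nat.le_total d k with h | h
  · rw [Nat.sub_eq_zero_of_le h]
    simpa using (Real.exp_pos _).le
  · push_cast [h]
    rw [show (d : ℝ) - k + 1 = d + 1 - k by ring]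
    linarith [Real.exp_pos θ]

theorem mean_stepLaw_expTotal_le (hp : p ∈ Set.Ioo (0 : ℝ) 1) {θ : ℝ} (hθ : 0 ≤ θ) (s : ℕ)
    (σ : Layered) :
    mean (stepLaw p (Set.Ioo_subset_Ioc_self hp) s σ)
        (fun τ => ENNReal.ofReal (τ.expTotal θ (s + 1))) ≤
      ENNReal.ofReal (1 + expMoment p θ / (s + 1)) * ENNReal.ofReal (σ.expTotal θ s) +
        ENNReal.ofReal (Real.exp θ) := by
  have hφ := expMoment_pos hp hθ
  have hu : ∀ u : ℕ, mean ((geo p (Set.Ioo_subset_Ioc_self hp)).map fun x => σ.step s u x)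
        (fun τ => ENNReal.ofReal (τ.expTotal θ (s + 1))) ≤
      ENNReal.ofReal (σ.expTotal θ s + (Real.exp θ + expMoment p θ * Real.exp (θ * σ.depth u))) := by
    intro u
    rw [mean_map]
    simp only [Function.comp_def, Layered.expTotal_step,
      ENNReal.ofReal_add (σ.expTotal_nonneg θ s) (Real.exp_pos _).le]
    rw [mean_add, mean_const, ENNReal.ofReal_add (σ.expTotal_nonneg θ s) (by positivity)]
    exact add_le_add le_rfl (mean_geo_exp_le hp hθ _)
  have hnn : ∀ u : Fin (s + 1),
      0 ≤ σ.expTotal θ s + (Real.exp θ + expMoment p θ * Real.exp (θ * σ.depth u)) := fun u =>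
    add_nonneg (σ.expTotal_nonneg θ s) (by positivity)
  rw [stepLaw, mean_bind, mean_uniformOfFintype_fin]
  refine (mul_le_mul_left (Finset.sum_le_sum fun (u : Fin (s + 1)) _ => hu u) _).trans (le_of_eq ?_)
  have hs : ((s : ℝ≥0∞) + 1)⁻¹ = ENNReal.ofReal ((s : ℝ) + 1)⁻¹ := by
    rw [ENNReal.ofReal_inv_of_pos (by positivity), ENNReal.ofReal_add (by positivity)
      zero_le_one, ENNReal.ofReal_natCast, ENNReal.ofReal_one]
  rw [← ENNReal.ofReal_sum_of_nonneg fun u _ => hnn u, hs,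
    ← ENNReal.ofReal_mul (Finset.sum_nonneg fun u _ => hnn u),
    ← ENNReal.ofReal_mul (by positivity),
    ← ENNReal.ofReal_add (mul_nonneg (by positivity) (σ.expTotal_nonneg θ s)) (Real.exp_pos _).le]
  congr 1
  have ht : σ.expTotal θ s = ∑ i : Fin (s + 1), Real.exp (θ * σ.depth i) := Finset.sum_range _
  rw [Finset.sum_add_distrib, Finset.sum_add_distrib, ← Finset.mul_sum, ← ht]
  simp
  field_simp
  ring

theorem mean_layeredLaw_expTotal_le (hp : p ∈ Set.Ioo (0 : ℝ) 1) {θ : ℝ} (hθ : 0 ≤ θ)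
    (h1 : 1 ≤ expMoment p θ) (c : ℕ → Bool) (k : ℕ) :
    mean (layeredLaw p (Set.Ioo_subset_Ioc_self hp) 0 c k)
        (fun τ => ENNReal.ofReal (τ.expTotal θ k)) ≤
      ENNReal.ofReal (Real.exp θ * ((k : ℝ) + 1) ^ expMoment p θ * harmonic (k + 1)) := by
  have hH : ∀ k : ℕ, (0 : ℝ) ≤ (harmonic k : ℝ) := fun k => by
    exact_mod_cast Finset.sum_nonneg fun i _ => by positivity
  induction k with
  | zero =>
    rw [layeredLaw, mean_map]
    refine le_trans (mean_mono (g := fun _ => 1) fun g _ => ?_) ?_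
    · simp [Layered.expTotal]
    · rw [mean_const]
      simp [harmonic, ENNReal.one_le_ofReal, hθ]
  | succ k ih =>
    rw [layeredLaw, zero_add, mean_bind]
    refine (mean_mono fun σ _ => mean_stepLaw_expTotal_le hp hθ k σ).trans ?_
    rw [mean_add, mean_const, mean_mul_left]
    refine (add_le_add (mul_le_mul_right ih _) le_rfl).trans ?_
    have hφ := expMoment_pos hp hθ
    rw [← ENNReal.ofReal_mul (by positivity),
      ← ENNReal.ofReal_add (mul_nonneg (by positivity) (mul_nonneg (by positivity) (hH _)))
        (Real.exp_pos _).le]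
    refine ENNReal.ofReal_le_ofReal ?_
    -- Bernoulli's inequality, which needs `1 ≤ φ θ`.
    have hb : 1 + expMoment p θ / ((k : ℝ) + 1) ≤ (1 + 1 / ((k : ℝ) + 1)) ^ expMoment p θ := by
      have := one_add_mul_self_le_rpow_one_add (s := 1 / ((k : ℝ) + 1))
        (by have : (0 : ℝ) ≤ 1 / ((k : ℝ) + 1) := by positivity
            linarith) h1
      rwa [mul_one_div] at this
    have hpow : (1 + expMoment p θ / ((k : ℝ) + 1)) * ((k : ℝ) + 1) ^ expMoment p θ ≤
        ((k + 1 : ℕ) + 1 : ℝ) ^ expMoment p θ := by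
      refine (mul_le_mul_of_nonneg_right hb (by positivity)).trans (le_of_eq ?_)
      rw [← Real.mul_rpow (by positivity) (by positivity)]
      congr 1
      push_cast
      field_simp
    -- The truncation error of one step is at most the main power times `1 / (k + 2)`; these terms
    -- sum to the harmonic number. Here too `1 ≤ φ θ` is essential.
    have hone : 1 ≤ ((k + 1 : ℕ) + 1 : ℝ) ^ expMoment p θ * (((k + 1 : ℕ) : ℝ) + 1)⁻¹ := by
      rw [← div_eq_mul_inv, one_le_div (by positivity)]
      refine Real.self_le_rpow_of_one_le ?_ h1
      push_cast
      linarith [Nat.cast_nonneg (α := ℝ) k]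
    have hsucc : (harmonic (k + 1 + 1) : ℝ) = harmonic (k + 1) + (((k + 1 : ℕ) : ℝ) + 1)⁻¹ := by
      rw [harmonic_succ]
      push_cast
      ring
    rw [hsucc]
    have e1 := mul_le_mul_of_nonneg_right hpow (mul_nonneg (Real.exp_pos θ).le (hH (k + 1)))
    have e2 := mul_le_mul_of_nonneg_left hone (Real.exp_pos θ).le
    nlinarith

theorem layeredLaw_deep_le (hp : p ∈ Set.Ioo (0 : ℝ) 1) {θ : ℝ} (hθ : 0 ≤ θ)
    (h1 : 1 ≤ expMoment p θ) (c : ℕ → Bool) (k : ℕ) (a : ℝ) :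
    (layeredLaw p (Set.Ioo_subset_Ioc_self hp) 0 c k).toOuterMeasure
        {σ | ∃ i < k + 1, a < σ.depth i} ≤
      ENNReal.ofReal (Real.exp (-(θ * a)) *
        (Real.exp θ * ((k : ℝ) + 1) ^ expMoment p θ * harmonic (k + 1))) := by
  have hmark : (layeredLaw p (Set.Ioo_subset_Ioc_self hp) 0 c k).toOuterMeasure
        {σ | ∃ i < k + 1, a < σ.depth i} ≤
      mean (layeredLaw p (Set.Ioo_subset_Ioc_self hp) 0 c k)
        (fun τ => ENNReal.ofReal (Real.exp (-(θ * a))) * ENNReal.ofReal (τ.expTotal θ k)) := by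
    refine toOuterMeasure_le_mean _ fun σ _ hσ => ?_
    obtain ⟨i, hi, hia⟩ := hσ
    rw [← ENNReal.ofReal_mul (Real.exp_pos _).le, ENNReal.one_le_ofReal]
    have h2 : Real.exp (θ * a) ≤ σ.expTotal θ k :=
      (Real.exp_le_exp.2 (mul_le_mul_of_nonneg_left hia.le hθ)).trans
        (Finset.single_le_sum (f := fun i => Real.exp (θ * σ.depth i))
          (fun _ _ => (Real.exp_pos _).le) (Finset.mem_range.2 hi))
    refine le_trans (le_of_eq ?_) (mul_le_mul_of_nonneg_left h2 (Real.exp_pos _).le)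
    rw [← Real.exp_add, neg_add_cancel, Real.exp_zero]
  refine hmark.trans ?_
  rw [mean_mul_left, ENNReal.ofReal_mul (Real.exp_pos _).le]
  exact mul_le_mul_right (mean_layeredLaw_expTotal_le hp hθ h1 c k) _

/-! ### The exponent of the upper bound -/

theorem isThreshold_p₀ : IsThreshold p₀ := existsUnique_isThreshold.choose_spec.1

/-- The numerator of `φ (1 / s) - 1` over `1 - s` factors: `p (1 - p) (2 - s)² - (1 - s) = (p - (1 -
p)(1 - s)) * ((1 - p) - p (1 - s))`. The second factor is positive because `exp (1 / s) > 1`; the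
sign of the first is where `p₀` enters. -/
theorem one_le_expMoment_of_p₀_le (hp : p ∈ Set.Ioo (0 : ℝ) 1) (h : p₀ ≤ p) :
    1 ≤ expMoment p (1 / surferS p hp) := by
  obtain ⟨⟨hs0, hs1⟩, hs⟩ := isSurferS_surferS hp
  have hz := exp_one_div_surferS hp
  have hφ : cL p hp = surferS p hp * expMoment p (1 / surferS p hp) := cL_eq hp
  rw [cL, hz] at hφ
  set s := surferS p hp
  obtain ⟨hp0, hp1⟩ := hp
  have h1s : 0 < 1 - s := by linarith
  have hφ' : expMoment p (1 / s) = p * (1 - p) * (2 - s) ^ 2 / (1 - s) := by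
    have : s * expMoment p (1 / s) = s * (p * (1 - p) * (2 - s) ^ 2 / (1 - s)) := by
      rw [← hφ]
      field_simp
    exact mul_left_cancel₀ hs0.ne' this
  have hz1 : 1 < (1 - p) * (2 - s) / (1 - s) := hz ▸ Real.one_lt_exp_iff.2 (by positivity)
  rw [one_lt_div h1s] at hz1
  -- If this factor were negative, then `s < (1 - 2p) / (1 - p)` and `exp (1 / s) < (1 - p) / p`.
  -- For `p₀ ≤ p` the threshold inequality then gives `s * log (...) < 1`, contradicting the
  -- equation of `s`.
  have hu : 0 ≤ p - (1 - p) * (1 - s) := by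
    by_contra! hneg
    have hp2 : p < 1 / 2 := by
      by_contra! hp2
      nlinarith
    obtain ⟨⟨t0, t1⟩, ht⟩ := isThreshold_p₀
    have hlog : Real.log ((1 - p) / p) ≤ (1 - p) / (1 - 2 * p) := by
      have e1 : Real.log ((1 - p) / p) ≤ Real.log ((1 - p₀) / p₀) := by
        refine Real.log_le_log (div_pos (by linarith) hp0) ?_
        rw [div_le_div_iff₀ hp0 t0]
        nlinarith
      have e2 : (1 - p₀) / (1 - 2 * p₀) ≤ (1 - p) / (1 - 2 * p) := by
        rw [div_le_div_iff₀ (by linarith) (by linarith)]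
        nlinarith
      linarith
    have hlt : Real.log ((1 - p) * (2 - s) / (1 - s)) < Real.log ((1 - p) / p) := by
      refine Real.log_lt_log (lt_trans one_pos ((one_lt_div h1s).2 hz1)) ?_
      rw [div_lt_div_iff₀ h1s hp0]
      nlinarith
    have hsr : s < (1 - 2 * p) / (1 - p) := by
      rw [lt_div_iff₀ (by linarith)]
      linarith
    have hfin : s * Real.log ((1 - p) * (2 - s) / (1 - s)) < 1 := by
      calc s * Real.log ((1 - p) * (2 - s) / (1 - s)) < s * Real.log ((1 - p) / p) :=
            mul_lt_mul_of_pos_left hlt hs0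
        _ ≤ s * ((1 - p) / (1 - 2 * p)) := mul_le_mul_of_nonneg_left hlog hs0.le
        _ ≤ (1 - 2 * p) / (1 - p) * ((1 - p) / (1 - 2 * p)) :=
            mul_le_mul_of_nonneg_right hsr.le (div_nonneg (by linarith) (by linarith))
        _ = 1 := by
            have : 1 - 2 * p ≠ 0 := by linarith
            have : 1 - p ≠ 0 := by linarith
            field_simp
    linarith
  rw [hφ', one_le_div h1s]
  have hv : 0 ≤ (1 - p) - p * (1 - s) := by nlinarith
  nlinarith [mul_nonneg hu hv]

theorem exists_exponent_cU (hp : p ∈ Set.Ioo (0 : ℝ) 1) :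
    ∃ θ : ℝ, 0 < θ ∧ 1 ≤ expMoment p θ ∧ expMoment p θ = θ * cU p hp := by
  by_cases h : p₀ ≤ p
  · obtain ⟨⟨hs0, -⟩, -⟩ := isSurferS_surferS hp
    refine ⟨1 / surferS p hp, by positivity, one_le_expMoment_of_p₀_le hp h, ?_⟩
    rw [cU, if_pos h, cL_eq]
    field_simp
  · obtain ⟨⟨-, t1⟩, -⟩ := isThreshold_p₀
    have hp2 : p < 1 / 2 := (not_le.1 h).trans t1
    have hp0 := hp.1
    have hz : 1 < (1 - p) / p := by
      rw [one_lt_div hp0]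
      linarith
    have hθ := Real.log_pos hz
    have hφ : expMoment p (Real.log ((1 - p) / p)) = 1 := by
      rw [expMoment, two_mul, Real.exp_add, Real.exp_log (by linarith)]
      have hq : 1 - p ≠ 0 := by linarith
      have : (1 - p) / p - (1 - p) = (1 - p) ^ 2 / p := by
        field_simp
      rw [this]
      field_simp
    refine ⟨Real.log ((1 - p) / p), hθ, hφ.ge, ?_⟩
    rw [cU, if_neg h, hφ, mul_inv_cancel₀ hθ.ne']

/-! ### The two bounds on the diameter -/

theorem treeLaw_eq_map_layeredLaw (hp : p ∈ Set.Ioc (0 : ℝ) 1) (r k : ℕ) (c : ℕ → Bool) :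
    treeLaw p hp (r + k + 1) =
      (layeredLaw p hp r c k).map fun σ => underlying (r + k + 1) σ.graph := by
  rw [treeLaw, Nat.add_sub_cancel, ← map_graph_layeredLaw p hp r c k, PMF.map_comp]
  rfl

theorem tendsto_treeLaw_diam_gt (hp : p ∈ Set.Ioo (0 : ℝ) 1) {a : ℝ} (ha : cU p hp < a) :
    Tendsto (fun n : ℕ => (treeLaw p (Set.Ioo_subset_Ioc_self hp) n).toOuterMeasure
      {T : SimpleGraph (Fin n) | 2 * a * Real.log n < (T.diam : ℝ)}) atTop (𝓝 0) := by
  obtain ⟨θ, hθ, hφ1, hφ⟩ := exists_exponent_cU hp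
  set δ := θ * a - expMoment p θ with hδ
  have hδ0 : 0 < δ := by
    rw [hδ, hφ, ← mul_sub]
    exact mul_pos hθ (by linarith)
  -- With `t = log n`, the Markov bound is at most `exp θ * (1 + log n) * n ^ (-δ)`.
  have hlim : Tendsto (fun t : ℝ => Real.exp θ * ((1 + t) * Real.exp (-(δ * t)))) atTop (𝓝 0) := by
    have h1 := ((tendsto_rpow_mul_exp_neg_mul_atTop_nhds_zero 0 δ hδ0).add
      (tendsto_rpow_mul_exp_neg_mul_atTop_nhds_zero 1 δ hδ0)).const_mul (Real.exp θ)
    simp only [Real.rpow_zero, Real.rpow_one, ← add_mul, neg_mul, add_zero, mul_zero] at h1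
    exact h1
  have hlim' := ENNReal.tendsto_ofReal
    (hlim.comp (Real.tendsto_log_atTop.comp tendsto_natCast_atTop_atTop))
  rw [ENNReal.ofReal_zero] at hlim'
  refine tendsto_of_tendsto_of_tendsto_of_le_of_le' tendsto_const_nhds hlim'
    (Eventually.of_forall fun _ => zero_le) ?_
  filter_upwards [eventually_ge_atTop 1] with n hn
  obtain ⟨k, rfl⟩ : ∃ k, n = 0 + k + 1 := ⟨n - 1, by omega⟩
  rw [treeLaw_eq_map_layeredLaw _ 0 k fun _ => true, PMF.toOuterMeasure_map_apply]
  have hN : ((0 + k + 1 : ℕ) : ℝ) = k + 1 := by push_cast; ring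
  have hN0 : (0 : ℝ) < k + 1 := by positivity
  rw [hN]
  refine (PMF.toOuterMeasure_mono _ ?_).trans ((layeredLaw_deep_le hp hθ.le hφ1 (fun _ => true) k
    (a * Real.log (k + 1))).trans (ENNReal.ofReal_le_ofReal ?_))
  · rintro σ ⟨hσ, hsupp⟩
    have hval := valid_of_mem_support_layeredLaw hsupp
    by_contra hcon
    simp only [Set.mem_ofPred_eq, not_exists, not_and, not_lt] at hcon
    have hfl : ∀ i < 0 + k + 1, σ.depth i ≤ ⌊a * Real.log (k + 1)⌋₊ := fun i hi =>
      Nat.le_floor (hcon i (by omega))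
    have hd := hval.diam_le le_rfl (by omega) hfl
    have h0 : 0 ≤ a * Real.log (k + 1) := (Nat.cast_nonneg _).trans (hcon 0 (by omega))
    have hd' : ((underlying (0 + k + 1) σ.graph).diam : ℝ) ≤ 2 * ⌊a * Real.log (k + 1)⌋₊ := by
      exact_mod_cast hd
    have := Nat.floor_le h0
    simp only [Set.mem_preimage, Set.mem_ofPred_eq] at hσ
    linarith
  · have hH : (harmonic (k + 1) : ℝ) ≤ 1 + Real.log (k + 1) := by
      have := harmonic_le_one_add_log (k + 1)
      push_cast at this
      exact this
    simp only [Function.comp_apply, hN]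
    rw [Real.rpow_def_of_pos hN0]
    calc _ ≤ Real.exp (-(θ * (a * Real.log (k + 1)))) * (Real.exp θ *
          Real.exp (Real.log (k + 1) * expMoment p θ) * (1 + Real.log (k + 1))) := by
          gcongr
      _ = Real.exp θ * ((1 + Real.log (k + 1)) *
          (Real.exp (-(θ * (a * Real.log (k + 1)))) *
            Real.exp (Real.log (k + 1) * expMoment p θ))) := by ring
      _ = _ := by
          rw [← Real.exp_add, hδ]
          ring_nf

theorem tendsto_treeLaw_diam_lt (hp : p ∈ Set.Ioo (0 : ℝ) 1) {a : ℝ} (ha : a < cL p hp) :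
    Tendsto (fun n : ℕ => (treeLaw p (Set.Ioo_subset_Ioc_self hp) n).toOuterMeasure
      {T : SimpleGraph (Fin n) | (T.diam : ℝ) < 2 * a * Real.log n}) atTop (𝓝 0) := by
  -- The maximum with `0` is needed because `a` may be negative, while the block argument requires
  -- `l > 0`.
  obtain ⟨l, hl1, hl2⟩ := exists_between (max_lt ha (cL_pos hp))
  have hla : a < l := (le_max_left _ _).trans_lt hl1
  have hl0 : 0 < l := (le_max_right _ _).trans_lt hl1
  obtain ⟨c, hc, M, hM, hdeep⟩ := exists_deep_of_color hp hl0 hl2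
  have hM0 : (0 : ℝ) < M := by positivity
  have hlim : Tendsto (fun m : ℕ => 2 * ENNReal.ofReal (Real.exp (-(c * m)))) atTop (𝓝 0) := by
    have h1 : Tendsto (fun m : ℕ => Real.exp (-(c * m))) atTop (𝓝 0) :=
      Real.tendsto_exp_neg_atTop_nhds_zero.comp
        (tendsto_natCast_atTop_atTop.const_mul_atTop hc)
    have h2 := ENNReal.Tendsto.const_mul (a := 2) (ENNReal.tendsto_ofReal h1)
      (Or.inr ENNReal.ofNat_ne_top)
    simpa using h2
  rw [ENNReal.tendsto_nhds_zero]
  intro e he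
  -- The zone size is fixed by the target error `e` before `n` grows.
  obtain ⟨m, hm, hm0⟩ := ((ENNReal.tendsto_nhds_zero.1 hlim e he).and
    (eventually_gt_atTop 0)).exists
  have hlog : ∀ᶠ n : ℕ in atTop,
      l * (Real.log (2 * m) + Real.log M) / (l - a) ≤ Real.log n :=
    (Real.tendsto_log_atTop.comp tendsto_natCast_atTop_atTop).eventually_ge_atTop _
  filter_upwards [hlog, eventually_ge_atTop (2 * m)] with n hn1 hn2
  refine le_trans ?_ hm
  have hm0' : (0 : ℝ) < m := by exact_mod_cast hm0
  have hn0 : (0 : ℝ) < n := by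
    have : 0 < n := by omega
    exact_mod_cast this
  set K := Nat.log M (n / (2 * m)) with hK
  have hdiv : n / (2 * m) ≠ 0 := (Nat.div_pos hn2 (by omega)).ne'
  have hK1 : M ^ K * (2 * m) ≤ n :=
    (Nat.mul_le_mul_right _ (Nat.pow_log_le_self M hdiv)).trans (Nat.div_mul_le_self _ _)
  have hK2 : n < M ^ (K + 1) * (2 * m) :=
    (Nat.div_lt_iff_lt_mul (by omega)).1 (Nat.lt_pow_succ_log_self (by omega) _)
  obtain ⟨k, rfl⟩ : ∃ k, n = 2 * m - 1 + k + 1 := ⟨n - 2 * m, by omega⟩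
  have hkm : 2 * m + k = 2 * m - 1 + k + 1 := by omega
  have hb := fun b => hdeep m hm0 b K k (by omega) (by omega)
  rw [treeLaw_eq_map_layeredLaw _ (2 * m - 1) k (halfColor m), PMF.toOuterMeasure_map_apply,
    two_mul (ENNReal.ofReal _)]
  refine (PMF.toOuterMeasure_mono _ ?_).trans ((MeasureTheory.measure_union_le _ _).trans
    (add_le_add (hb true) (hb false)))
  rintro σ ⟨hσ, hsupp⟩
  have hval := valid_of_mem_support_layeredLaw hsupp
  simp only [Set.mem_preimage, Set.mem_ofPred_eq] at hσ
  by_contra hcon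
  simp only [Set.mem_union, Set.mem_ofPred_eq, not_or, not_forall, not_lt] at hcon
  obtain ⟨⟨i, hi, hci, hdi⟩, j, hj, hcj, hdj⟩ := hcon
  have hd := hval.add_depth_le_diam le_rfl (hkm ▸ hi) (hkm ▸ hj) hci hcj
  have hd' : (σ.depth i : ℝ) + σ.depth j ≤ (underlying (2 * m - 1 + k + 1) σ.graph).diam := by
    exact_mod_cast hd
  have hlogn : Real.log (2 * m - 1 + k + 1 : ℕ) ≤ (K + 1) * Real.log M + Real.log (2 * m) := by
    have : ((2 * m - 1 + k + 1 : ℕ) : ℝ) ≤ (M : ℝ) ^ (K + 1) * (2 * m) := by exact_mod_cast hK2.le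
    refine (Real.log_le_log hn0 this).trans (le_of_eq ?_)
    rw [Real.log_mul (by positivity) (by positivity), Real.log_pow]
    push_cast
    ring
  rw [div_le_iff₀ (by linarith)] at hn1
  have h3 := mul_le_mul_of_nonneg_left hlogn hl0.le
  nlinarith

end RandomSurfer

/-! ### Union bound over the two failure events -/

theorem theorem3 (p : ℝ) (hp : p ∈ Set.Ioo (0 : ℝ) 1) (ε : ℝ) (hε : 0 < ε) :
    Tendsto
      (fun n : ℕ =>
        (RandomSurfer.treeLaw p (Set.Ioo_subset_Ioc_self hp) n).toOuterMeasure
          {T : SimpleGraph (Fin n) |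
            (2 * RandomSurfer.cL p hp - ε) * Real.log n ≤ (T.diam : ℝ) ∧
              (T.diam : ℝ) ≤ (2 * RandomSurfer.cU p hp + ε) * Real.log n})
      atTop (𝓝 1) := by
  have hlow := RandomSurfer.tendsto_treeLaw_diam_lt hp
    (a := RandomSurfer.cL p hp - ε / 2) (by linarith)
  have hupp := RandomSurfer.tendsto_treeLaw_diam_gt hp
    (a := RandomSurfer.cU p hp + ε / 2) (by linarith)
  have hsub := ENNReal.Tendsto.sub (tendsto_const_nhds (x := (1 : ENNReal))) (hlow.add hupp)
    (Or.inl ENNReal.one_ne_top)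
  rw [add_zero, tsub_zero] at hsub
  refine tendsto_of_tendsto_of_tendsto_of_le_of_le hsub tendsto_const_nhds (fun n => ?_)
    fun n => ?_
  · rw [tsub_le_iff_right]
    set μ := RandomSurfer.treeLaw p (Set.Ioo_subset_Ioc_self hp) n
    have huniv : μ.toOuterMeasure Set.univ = 1 :=
      (PMF.toOuterMeasure_apply_eq_one_iff _ _).2 (Set.subset_univ _)
    rw [← huniv]
    refine le_trans (MeasureTheory.measure_mono ?_) ((MeasureTheory.measure_union_le _ _).trans
      (add_le_add le_rfl (MeasureTheory.measure_union_le _ _)))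
    intro T _
    by_cases h1 : (T.diam : ℝ) < 2 * (RandomSurfer.cL p hp - ε / 2) * Real.log n
    · exact Or.inr (Or.inl h1)
    by_cases h2 : 2 * (RandomSurfer.cU p hp + ε / 2) * Real.log n < (T.diam : ℝ)
    · exact Or.inr (Or.inr h2)
    refine Or.inl ⟨?_, ?_⟩
    · rw [not_lt] at h1
      refine le_trans (le_of_eq ?_) h1
      ring
    · rw [not_lt] at h2
      refine h2.trans (le_of_eq ?_)
      ring
  · refine (MeasureTheory.measure_mono (Set.subset_univ _)).trans (le_of_eq ?_)
    exact (PMF.toOuterMeasure_apply_eq_one_iff _ _).2 (Set.subset_univ _)
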